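/- Fix constants $a,b,\varepsilon>0$, $r_2>r_1>0$ and $c_1,c_2>0$. For $n\ge 1$ and $\rho\ge 0$ let $U_n(\rho)=\{\theta\in\mathbb R^n: |\theta_j|\le\rho \text{ for all } j\}$. Let $A=I+X$ be a real symmetric positive definite $n\times n$ matrix with $|X_{jk}|\le a/n$, $X_{jj}=0$ and $\|A^{-1}\|_2\le b$ (spectral norm). Let $H:\mathbb R^n\to\mathbb R$ be differentiable with, for all $\theta\in\mathbb R^n$, $$H(\theta)\le c_1\frac{\theta^TA\theta}{n},\qquad \Big\|\frac{\partial H(\theta)}{\partial\theta}\Big\|_\infty\le c_2\,\frac{\|\theta\|_\infty^3+\|\theta\|_\infty}{n},$$ and put $F(\theta)=-\theta^TA\theta+H(\theta)$. Let $\Omega\subset\mathbb R^n$ be a Lebesgue measurable set with $U_n(r_1n^\varepsilon)\subset\Omega\subset U_n(r_2n^\varepsilon)$. Write $$\langle g\rangle_{F,\Omega}=\int_\Omega g(\theta)e^{F(\theta)}\,d\theta,\qquad \langle 1\rangle_\Omega=\int_\Omega e^{-\theta^TA\theta}\,d\theta,\qquad \langle 1\rangle=\int_{\mathbb R^n}e^{-\theta^TA\theta}\,d\theta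 .$$ Here $f=O(g)$ means $|f|\le C|g|$ with a constant $C>0$ that depends only on $a,b,\varepsilon,r_1,r_2,c_1,c_2$ (not on $n,A,H,\Omega$ or the indices). Then there is $c_3=c_3(r_1,r_2,c_1,c_2,a,b,\varepsilon)>0$ such that $$\langle 1\rangle_\Omega=\big(1+O(\exp(-c_3n^{2\varepsilon}))\big)\langle 1\rangle,\qquad \langle 1\rangle_{F,\Omega}=O(\langle 1\rangle),$$ for all $1\le k\le n$ $$\langle\theta_k^2\rangle_{F,\Omega}=\tfrac12\langle1\rangle_{F,\Omega}+O(n^{-1+4\varepsilon})\langle1\rangle,\qquad \langle\theta_k^4\rangle_{F,\Omega}=\tfrac34\langle1\rangle_{F,\Omega}+O(n^{-1+7\varepsilon})\langle1\rangle,$$ and for all $k\ne l$ $$\langle\theta_k\theta_l\rangle_{F,\Omega}=O(n^{-1+5\varepsilon})\langle1\rangle,\qquad \langle\theta_k\theta_l^3\rangle_{F,\Omega}=O(n^{-1+7\varepsilon})\langle1\rangle,$$ $$\langle\theta_k^2\theta_l^2\rangle_{F,\Omega}=\tfrac14\langle1\rangle_{F,\Omega}+O(n^{-1+7\varepsilon})\langle1\rangle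 .$$ In addition, let $c_4>0$. Then for every $p\in\mathbb R^n$ with $\|p\|_\infty\le c_4n^{-1/2}$ and every $1\le k\le n$, $$\big\langle\theta_ke^{i\theta^Tp-ip_k\theta_k}\big\rangle_{F,\Omega}=\frac i2\sum_{j\ne k}p_j(A^{-1})_{jk}\,\big\langle e^{i\theta^Tp-ip_k\theta_k}\big\rangle_{F-\frac12p_k^2\theta_k^2,\ \Omega}+O(n^{-1+5\varepsilon})\langle1\rangle ,$$ where the constant in this last $O$ may depend also on $c_4$. -/

import Mathlib

open MeasureTheory
open scoped Matrix

noncomputable section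

namespace GaussInt

/-- The cube `U_n(ρ)`: all `θ ∈ ℝⁿ` with `|θ_j| ≤ ρ` for every `j`. -/
def cube (n : ℕ) (ρ : ℝ) : Set (Fin n → ℝ) := {θ | ∀ j, |θ j| ≤ ρ}

/-- The spectral norm `‖A‖₂`: the operator norm for the Euclidean norm on `ℝⁿ`. -/
def specNorm {n : ℕ} (A : Matrix (Fin n) (Fin n) ℝ) : ℝ :=
  ‖Matrix.toEuclideanCLM (n := Fin n) (𝕜 := ℝ) A‖

/-- The quadratic form `θᵀ A θ`. -/
def quad {n : ℕ} (A : Matrix (Fin n) (Fin n) ℝ) (θ : Fin n → ℝ) : ℝ := θ ⬝ᵥ (A *ᵥ θ)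

/-- `A = I + X` is symmetric positive definite, `|X_jk| ≤ a / n`, `X_jj = 0`, `‖A⁻¹‖₂ ≤ b`. -/
structure IsAdmissible {n : ℕ} (a b : ℝ) (A : Matrix (Fin n) (Fin n) ℝ) : Prop where
  posDef : A.PosDef
  entry_le : ∀ j k, |(A - 1) j k| ≤ a / n
  diag_eq : ∀ j, (A - 1) j j = 0
  inv_le : specNorm A⁻¹ ≤ b

/-- The gradient `∂H/∂θ`, as the vector of partial derivatives. -/
def grad {n : ℕ} (H : (Fin n → ℝ) → ℝ) (θ : Fin n → ℝ) : Fin n → ℝ :=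
  fun j => fderiv ℝ H θ (Pi.single j 1)

/-- The two growth assumptions on the perturbation `H`. The norm on `Fin n → ℝ` is the
maximum norm. -/
structure IsPerturbation {n : ℕ} (c₁ c₂ : ℝ) (A : Matrix (Fin n) (Fin n) ℝ)
    (H : (Fin n → ℝ) → ℝ) : Prop where
  differentiable : Differentiable ℝ H
  le_quad : ∀ θ, H θ ≤ c₁ * quad A θ / n
  grad_le : ∀ θ, ‖grad H θ‖ ≤ c₂ * (‖θ‖ ^ 3 + ‖θ‖) / n

/-- `F(θ) = -θᵀ A θ + H(θ)`. -/
def action {n : ℕ} (A : Matrix (Fin n) (Fin n) ℝ) (H : (Fin n → ℝ) → ℝ) :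
    (Fin n → ℝ) → ℝ :=
  fun θ => -quad A θ + H θ

/-- `⟨g⟩_{F,Ω} = ∫_Ω g(θ) e^{F(θ)} dθ`, for a real- or complex-valued `g`. -/
def bracket {n : ℕ} {E : Type} [NormedAddCommGroup E] [NormedSpace ℝ E]
    (F : (Fin n → ℝ) → ℝ) (Ω : Set (Fin n → ℝ)) (g : (Fin n → ℝ) → E) : E :=
  ∫ θ in Ω, Real.exp (F θ) • g θ

/-- `⟨1⟩ = ∫_{ℝⁿ} e^{-θᵀ A θ} dθ`. -/
def gaussMass {n : ℕ} (A : Matrix (Fin n) (Fin n) ℝ) : ℝ :=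
  bracket (action A 0) Set.univ (fun _ => (1 : ℝ))

/-- The oscillating factor `e^{i θᵀp - i p_k θ_k}`. -/
def osc {n : ℕ} (p : Fin n → ℝ) (k : Fin n) (θ : Fin n → ℝ) : ℂ :=
  Complex.exp (Complex.I * ((θ ⬝ᵥ p : ℝ) : ℂ) - Complex.I * ((p k * θ k : ℝ) : ℂ))

end GaussInt

end

/-! Everything comes from one Gaussian integration by parts. Put `N = n^ε` and `v = A⁻¹ e_k`. The
derivative of `θᵀAθ` along `v` is `2θ_k`, so for an observable `g` the total `v`-derivative of `e^F
g` is `e^F (∂_v g - 2θ_k g + (∂_v H) g)`. If its integral vanished and the `H` term were small, one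
would have `⟨θ_k g⟩ ≈ ½⟨∂_v g⟩`. Taking `g` to be a coordinate, a cubic monomial or the oscillating
factor then gives all the moment formulas.

Three estimates justify this, uniformly in the dimension. First, `A⁻¹ - I = -X + X A⁻¹ X` has
entries `O(1/n)` (`IsAdmissible.abs_inv_sub_one_le`). Hence the columns of `A⁻¹` have bounded `ℓ¹`
norm, which against the sup-norm bound on the gradient gives `∂_v H = O(N³/n)` on the inner cube;
and derivatives of coordinates are `δ_jk + O(1/n)`.

Second, on the outer cube `e^F` is at most a constant times a Gaussian `e^{-s θᵀAθ}` of mass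
`O(⟨1⟩)` (`exists_exp_action_le`). A Chernoff bound makes its mass outside cubes of side of order
`N` exponentially small (`setIntegral_compl_cube_le`).

Third, `Ω` may have an arbitrary boundary, so a smooth cutoff supported in the inner cube replaces
boundary terms by tail terms (`exists_norm_bracket_le`). The outcome is `SteinBound`: the identity
holds up to `O((G₀N³ + G₁)/n)⟨1⟩`, where `G₀`, `G₁` bound `g`, `∂_v g` on `Ω`. -/

namespace GaussInt

variable {n : ℕ}

/-! ### Linear algebra: the quadratic form and the entries of the inverse -/

lemma abs_dotProduct_mulVec_le (B : Matrix (Fin n) (Fin n) ℝ) (x y : Fin n → ℝ) :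
    |x ⬝ᵥ B *ᵥ y| ≤ specNorm B * (‖WithLp.toLp 2 x‖ * ‖WithLp.toLp 2 y‖) := by
  have h := Matrix.inner_toEuclideanCLM B (WithLp.toLp 2 x) (WithLp.toLp 2 y)
  simp only at h
  rw [← h]
  refine (abs_real_inner_le_norm _ _).trans ?_
  have := (Matrix.toEuclideanCLM (n := Fin n) (𝕜 := ℝ) B).le_opNorm (WithLp.toLp 2 y)
  unfold specNorm
  calc _ ≤ ‖WithLp.toLp 2 x‖ * (‖Matrix.toEuclideanCLM (n := Fin n) (𝕜 := ℝ) B‖ *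
        ‖WithLp.toLp 2 y‖) := by gcongr
    _ = _ := by ring

lemma norm_toLp_sq (x : Fin n → ℝ) : ‖WithLp.toLp 2 x‖ ^ 2 = ∑ i, x i ^ 2 := by
  rw [EuclideanSpace.real_norm_sq_eq]

lemma dotProduct_self_eq (x : Fin n → ℝ) : x ⬝ᵥ x = ‖WithLp.toLp 2 x‖ ^ 2 := by
  rw [norm_toLp_sq]
  simp [dotProduct, sq]

lemma dotProduct_mulVec_comm {A : Matrix (Fin n) (Fin n) ℝ} (hA : A.PosDef) (x y : Fin n → ℝ) :
    x ⬝ᵥ A *ᵥ y = y ⬝ᵥ A *ᵥ x := by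
  have h : Aᵀ = A := by simpa [Matrix.IsHermitian] using hA.1
  rw [Matrix.dotProduct_mulVec, dotProduct_comm, ← Matrix.mulVec_transpose, h]

lemma quad_nonneg {A : Matrix (Fin n) (Fin n) ℝ} (hA : A.PosDef) (x : Fin n → ℝ) :
    0 ≤ quad A x := by
  simpa [quad] using hA.posSemidef.dotProduct_mulVec_nonneg x

lemma quad_add_smul {A : Matrix (Fin n) (Fin n) ℝ} (hA : A.PosDef) (x v : Fin n → ℝ) (t : ℝ) :
    quad A (x + t • v) = quad A x + 2 * t * (x ⬝ᵥ A *ᵥ v) + t ^ 2 * quad A v := by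
  have h := dotProduct_mulVec_comm hA v x
  simp only [quad, Matrix.mulVec_add, Matrix.mulVec_smul, add_dotProduct, dotProduct_add,
    smul_dotProduct, dotProduct_smul, smul_eq_mul, h]
  ring

lemma quad_smul (A : Matrix (Fin n) (Fin n) ℝ) (t : ℝ) (x : Fin n → ℝ) :
    quad A (t • x) = t ^ 2 * quad A x := by
  simp only [quad, Matrix.mulVec_smul, smul_dotProduct, dotProduct_smul, smul_eq_mul]
  ring

lemma mul_inv_of_posDef {A : Matrix (Fin n) (Fin n) ℝ} (hA : A.PosDef) : A * A⁻¹ = 1 :=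
  Matrix.mul_nonsing_inv A ((Matrix.isUnit_iff_isUnit_det A).1 hA.isUnit)

lemma inv_mul_of_posDef {A : Matrix (Fin n) (Fin n) ℝ} (hA : A.PosDef) : A⁻¹ * A = 1 :=
  Matrix.nonsing_inv_mul A ((Matrix.isUnit_iff_isUnit_det A).1 hA.isUnit)

/-- Positivity of the form at `x - b⁻¹A⁻¹x` gives `quad A x ≥ 2b⁻¹|x|² - b⁻² xᵀA⁻¹x`, and `xᵀA⁻¹x ≤
b|x|²`; no diagonalisation is needed. -/
lemma le_quad {b : ℝ} (hb : 0 < b) {A : Matrix (Fin n) (Fin n) ℝ} (hA : A.PosDef)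
    (hinv : specNorm A⁻¹ ≤ b) (x : Fin n → ℝ) : b⁻¹ * ∑ i, x i ^ 2 ≤ quad A x := by
  have h0 := quad_nonneg hA (x + (-b⁻¹) • (A⁻¹ *ᵥ x))
  have h1 : A *ᵥ (A⁻¹ *ᵥ x) = x := by
    rw [Matrix.mulVec_mulVec, mul_inv_of_posDef hA, Matrix.one_mulVec]
  have h2 : quad A (A⁻¹ *ᵥ x) = x ⬝ᵥ A⁻¹ *ᵥ x := by
    rw [quad, h1, dotProduct_comm]
  rw [quad_add_smul hA, h1, h2, dotProduct_self_eq] at h0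
  have h3 : x ⬝ᵥ A⁻¹ *ᵥ x ≤ b * ‖WithLp.toLp 2 x‖ ^ 2 := by
    refine (le_abs_self _).trans ((abs_dotProduct_mulVec_le _ _ _).trans ?_)
    rw [← sq]
    gcongr
  rw [← norm_toLp_sq]
  have h4 : (-b⁻¹) ^ 2 * (x ⬝ᵥ A⁻¹ *ᵥ x) ≤ (-b⁻¹) ^ 2 * (b * ‖WithLp.toLp 2 x‖ ^ 2) := by
    gcongr
  have h5 : (-b⁻¹) ^ 2 * (b * ‖WithLp.toLp 2 x‖ ^ 2) = b⁻¹ * ‖WithLp.toLp 2 x‖ ^ 2 := by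
    field_simp
  linarith

lemma single_dotProduct_mulVec_single (B : Matrix (Fin n) (Fin n) ℝ) (j k : Fin n) :
    Pi.single j 1 ⬝ᵥ B *ᵥ Pi.single k 1 = B j k := by
  simp

lemma IsAdmissible.inv_diag_le {a b : ℝ} {A : Matrix (Fin n) (Fin n) ℝ} (hA : IsAdmissible a b A)
    (j : Fin n) : A⁻¹ j j ≤ b := by
  have h := abs_dotProduct_mulVec_le A⁻¹ (Pi.single j 1) (Pi.single j 1)
  rw [single_dotProduct_mulVec_single, PiLp.toLp_single,
    PiLp.norm_single] at h
  simp only [norm_one, mul_one] at h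
  exact (le_abs_self _).trans (h.trans hA.inv_le)

/-- In `A⁻¹ - I = -X + X A⁻¹ X` the first term is `O(1/n)` by assumption. By symmetry the `(j,k)`
entry of the second is `A⁻¹` paired with rows `j` and `k` of `X`, each of Euclidean norm at most
`a/√n`, so the spectral bound gives `a²b/n`. -/
lemma IsAdmissible.abs_inv_sub_one_le {a b : ℝ} (ha : 0 < a) (hb : 0 < b)
    {A : Matrix (Fin n) (Fin n) ℝ} (hA : IsAdmissible a b A) (j k : Fin n) :
    |(A⁻¹ - 1) j k| ≤ (a + a ^ 2 * b) / n := by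
  have hn : (0 : ℝ) < n := by exact_mod_cast j.pos
  set X := A - 1 with hX
  have hAX : A = 1 + X := by simp [hX]
  have h1 := mul_inv_of_posDef hA.posDef
  have h2 := inv_mul_of_posDef hA.posDef
  have hid : A⁻¹ - 1 = -X + X * A⁻¹ * X := by
    have e1 : X * A⁻¹ = 1 - A⁻¹ := by rw [hX, sub_mul, h1, one_mul]
    have e2 : A⁻¹ * X = 1 - A⁻¹ := by rw [hX, mul_sub, h2, mul_one]
    rw [e1, sub_mul, one_mul, e2]
    abel
  have hsymm : Xᵀ = X := by
    have : Aᵀ = A := by simpa [Matrix.IsHermitian] using hA.posDef.1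
    simp [hX, this]
  have hrow : ∀ i, ‖WithLp.toLp 2 (X i)‖ ≤ a / Real.sqrt n := by
    intro i
    refine abs_le_of_sq_le_sq' ?_ (by positivity) |>.2
    rw [norm_toLp_sq]
    calc ∑ l, X i l ^ 2 ≤ ∑ _l : Fin n, (a / n) ^ 2 := by
          refine Finset.sum_le_sum fun l _ => ?_
          rw [← sq_abs]
          have := hA.entry_le i l
          gcongr
      _ = (a / Real.sqrt n) ^ 2 := by
          rw [div_pow a (Real.sqrt n), Real.sq_sqrt hn.le]
          simp
          field_simp
  have hent : (X * A⁻¹ * X) j k = X j ⬝ᵥ A⁻¹ *ᵥ X k := by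
    have : X k = X *ᵥ Pi.single k 1 := by
      conv_lhs => rw [← hsymm]
      ext i
      simp
    rw [this, Matrix.mulVec_mulVec]
    simp only [Matrix.mulVec_single_one]
    rw [mul_assoc, Matrix.mul_apply]
    rfl
  have hXX : |(X * A⁻¹ * X) j k| ≤ a ^ 2 * b / n := by
    rw [hent]
    refine (abs_dotProduct_mulVec_le _ _ _).trans ?_
    calc specNorm A⁻¹ * (‖WithLp.toLp 2 (X j)‖ * ‖WithLp.toLp 2 (X k)‖)
        ≤ b * (a / Real.sqrt n * (a / Real.sqrt n)) := by
          gcongr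
          · exact hA.inv_le
          · exact hrow j
          · exact hrow k
      _ = a ^ 2 * b / n := by
          rw [div_mul_div_comm, Real.mul_self_sqrt hn.le]
          ring
  rw [hid, Matrix.add_apply, Matrix.neg_apply]
  refine (abs_add_le _ _).trans ?_
  rw [abs_neg, add_div]
  exact add_le_add (hA.entry_le j k) hXX

lemma IsAdmissible.abs_inv_le {a b : ℝ} (ha : 0 < a) (hb : 0 < b)
    {A : Matrix (Fin n) (Fin n) ℝ} (hA : IsAdmissible a b A) {j k : Fin n} (hjk : j ≠ k) :
    |A⁻¹ j k| ≤ (a + a ^ 2 * b) / n := by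
  simpa [hjk] using hA.abs_inv_sub_one_le ha hb j k

lemma IsAdmissible.abs_inv_diag_sub_one_le {a b : ℝ} (ha : 0 < a) (hb : 0 < b)
    {A : Matrix (Fin n) (Fin n) ℝ} (hA : IsAdmissible a b A) (k : Fin n) :
    |A⁻¹ k k - 1| ≤ (a + a ^ 2 * b) / n := by
  simpa using hA.abs_inv_sub_one_le ha hb k k

/-- A dimension-free `ℓ¹` bound on the direction of differentiation, dual to the sup-norm bounds on
the gradients of `H` and of the cutoff. -/
lemma IsAdmissible.sum_abs_inv_le {a b : ℝ} (ha : 0 < a) (hb : 0 < b)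
    {A : Matrix (Fin n) (Fin n) ℝ} (hA : IsAdmissible a b A) (k : Fin n) :
    ∑ j, |A⁻¹ j k| ≤ 1 + (a + a ^ 2 * b) := by
  have hn : (0 : ℝ) < n := by exact_mod_cast k.pos
  calc ∑ j, |A⁻¹ j k| ≤ ∑ j, ((if j = k then 1 else 0) + (a + a ^ 2 * b) / n) := by
        refine Finset.sum_le_sum fun j _ => ?_
        have h := hA.abs_inv_sub_one_le ha hb j k
        rw [Matrix.sub_apply, Matrix.one_apply] at h
        have h2 := abs_add_le (if j = k then (1 : ℝ) else 0)
          (A⁻¹ j k - if j = k then (1 : ℝ) else 0)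
        rw [add_sub_cancel] at h2
        have h3 : |(if j = k then (1 : ℝ) else 0)| = if j = k then 1 else 0 := by
          split_ifs <;> simp
        rw [h3] at h2
        linarith
    _ = 1 + (a + a ^ 2 * b) := by
        rw [Finset.sum_add_distrib]
        simp
        field_simp

lemma IsAdmissible.quad_le {a b : ℝ} (ha : 0 < a)
    {A : Matrix (Fin n) (Fin n) ℝ} (hA : IsAdmissible a b A) (x : Fin n → ℝ) :
    quad A x ≤ (1 + a) * n * ‖x‖ ^ 2 := by
  rcases Nat.eq_zero_or_pos n with rfl | hn0
  · simp [quad]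
  have hn : (0 : ℝ) < n := by exact_mod_cast hn0
  have hx : ∀ j, |x j| ≤ ‖x‖ := fun j => norm_le_pi_norm x j
  have h1 : quad A x = x ⬝ᵥ x + x ⬝ᵥ (A - 1) *ᵥ x := by
    rw [Matrix.sub_mulVec, Matrix.one_mulVec, dotProduct_sub, quad]
    ring
  have h2 : x ⬝ᵥ x ≤ n * ‖x‖ ^ 2 := by
    rw [dotProduct]
    calc _ ≤ ∑ _i : Fin n, ‖x‖ ^ 2 := by
          refine Finset.sum_le_sum fun i _ => ?_
          rw [← sq, ← sq_abs]
          have := hx i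
          gcongr
      _ = _ := by simp
  have h3 : x ⬝ᵥ (A - 1) *ᵥ x ≤ a * n * ‖x‖ ^ 2 := by
    simp only [dotProduct, Matrix.mulVec, Finset.mul_sum]
    calc _ ≤ ∑ _i : Fin n, ∑ _j : Fin n, ‖x‖ * (a / n * ‖x‖) := by
          refine Finset.sum_le_sum fun i _ => Finset.sum_le_sum fun j _ => ?_
          refine (le_abs_self _).trans ?_
          rw [abs_mul, abs_mul]
          have := hx i
          have := hx j
          have := hA.entry_le i j
          gcongr
      _ = _ := by
          simp
          field_simp
  rw [h1]
  linarith

/-! ### Directional derivatives of the form, and the cubes -/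

lemma continuous_quad (A : Matrix (Fin n) (Fin n) ℝ) : Continuous (quad A) := by
  unfold quad
  fun_prop

lemma hasLineDerivAt_quad {A : Matrix (Fin n) (Fin n) ℝ} (hA : A.PosDef) (x v : Fin n → ℝ) :
    HasLineDerivAt ℝ (quad A) (2 * (x ⬝ᵥ A *ᵥ v)) x v := by
  unfold HasLineDerivAt
  simp only [quad_add_smul hA]
  have h := (((hasDerivAt_id (0 : ℝ)).const_mul 2).mul_const (x ⬝ᵥ A *ᵥ v)).const_add (quad A x)
    |>.add (((hasDerivAt_id (0 : ℝ)).pow 2).mul_const (quad A v))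
  simpa using! h

/-- This is why the direction `A⁻¹ e_k` is used: along it the quadratic form differentiates to the
single coordinate `2θ_k`. -/
lemma dotProduct_mulVec_inv_single {A : Matrix (Fin n) (Fin n) ℝ} (hA : A.PosDef)
    (x : Fin n → ℝ) (k : Fin n) : x ⬝ᵥ A *ᵥ (A⁻¹ *ᵥ Pi.single k 1) = x k := by
  rw [Matrix.mulVec_mulVec, mul_inv_of_posDef hA, Matrix.one_mulVec]
  simp

lemma measurableSet_cube (n : ℕ) (ρ : ℝ) : MeasurableSet (cube n ρ) := by
  have : cube n ρ = ⋂ j, {θ : Fin n → ℝ | |θ j| ≤ ρ} := by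
    ext θ
    simp [cube]
  rw [this]
  exact (isClosed_iInter fun j =>
    isClosed_le (by fun_prop : Continuous fun θ : Fin n → ℝ => |θ j|) continuous_const).measurableSet

lemma mem_cube_iff_norm_le {ρ : ℝ} (hρ : 0 ≤ ρ) (θ : Fin n → ℝ) : θ ∈ cube n ρ ↔ ‖θ‖ ≤ ρ := by
  rw [pi_norm_le_iff_of_nonneg hρ]
  rfl

/-! ### Gaussian integrals: integrability, Laplace transform, scaling, tails -/

lemma integrable_exp_neg_sum_sq {c : ℝ} (hc : 0 < c) :
    Integrable (fun θ : Fin n → ℝ => Real.exp (-(c * ∑ i, θ i ^ 2))) := by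
  have h : Integrable (fun θ : Fin n → ℝ => ∏ i, Real.exp (-c * θ i ^ 2)) :=
    Integrable.fintype_prod (f := fun _ x => Real.exp (-c * x ^ 2))
      fun _ => integrable_exp_neg_mul_sq hc
  refine h.congr (Filter.Eventually.of_forall fun θ => ?_)
  simp only [← Real.exp_sum, neg_mul, Finset.sum_neg_distrib, Finset.mul_sum]

lemma integrable_exp_neg_quad_add {b : ℝ} (hb : 0 < b) {A : Matrix (Fin n) (Fin n) ℝ}
    (hA : A.PosDef) (hinv : specNorm A⁻¹ ≤ b) {s : ℝ} (hs : 0 < s) (t : ℝ) (j : Fin n) :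
    Integrable (fun θ => Real.exp (-(s * quad A θ) + t * θ j)) := by
  set c := s * b⁻¹ with hc
  have hc0 : 0 < c := by positivity
  have h := (integrable_exp_neg_sum_sq (n := n) (half_pos hc0)).const_mul
    (Real.exp (t ^ 2 / (2 * c)))
  refine h.mono' ?_ (Filter.Eventually.of_forall fun θ => ?_)
  · have := continuous_quad A
    exact (by fun_prop : Continuous fun θ : Fin n → ℝ =>
      Real.exp (-(s * quad A θ) + t * θ j)).aestronglyMeasurable
  · rw [Real.norm_eq_abs, Real.abs_exp, ← Real.exp_add, Real.exp_le_exp]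
    have h1 : c * ∑ i, θ i ^ 2 ≤ s * quad A θ := by
      rw [hc, mul_assoc]
      exact mul_le_mul_of_nonneg_left (le_quad hb hA hinv θ) hs.le
    have h2 : θ j ^ 2 ≤ ∑ i, θ i ^ 2 :=
      Finset.single_le_sum (f := fun i => θ i ^ 2) (fun i _ => sq_nonneg _) (Finset.mem_univ j)
    have h3 : t * θ j ≤ t ^ 2 / (2 * c) + c / 2 * θ j ^ 2 := by
      have : t ^ 2 / (2 * c) + c / 2 * θ j ^ 2 - t * θ j = (t - c * θ j) ^ 2 / (2 * c) := by
        field_simp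
        ring
      have : 0 ≤ (t - c * θ j) ^ 2 / (2 * c) := by positivity
      linarith
    have h4 : c / 2 * θ j ^ 2 ≤ c / 2 * ∑ i, θ i ^ 2 := by gcongr
    linarith

lemma integrable_exp_neg_quad {b : ℝ} (hb : 0 < b) {A : Matrix (Fin n) (Fin n) ℝ}
    (hA : A.PosDef) (hinv : specNorm A⁻¹ ≤ b) {s : ℝ} (hs : 0 < s) :
    Integrable (fun θ => Real.exp (-(s * quad A θ))) := by
  refine (integrable_exp_neg_sum_sq (n := n) (c := s * b⁻¹) (by positivity)).mono' ?_
    (Filter.Eventually.of_forall fun θ => ?_)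
  · have := continuous_quad A
    exact (by fun_prop : Continuous fun θ : Fin n → ℝ =>
      Real.exp (-(s * quad A θ))).aestronglyMeasurable
  · rw [Real.norm_eq_abs, Real.abs_exp, Real.exp_le_exp, neg_le_neg_iff, mul_assoc]
    exact mul_le_mul_of_nonneg_left (le_quad hb hA hinv θ) hs.le

/-- Completing the square: translation by `(t/2s) A⁻¹ e_j` absorbs the linear term. -/
lemma integral_exp_neg_quad_add {A : Matrix (Fin n) (Fin n) ℝ}
    (hA : A.PosDef) {s : ℝ} (hs : 0 < s) (t : ℝ) (j : Fin n) :
    ∫ θ, Real.exp (-(s * quad A θ) + t * θ j) =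
      Real.exp (t ^ 2 / (4 * s) * A⁻¹ j j) * ∫ θ, Real.exp (-(s * quad A θ)) := by
  set u := A⁻¹ *ᵥ Pi.single j (1 : ℝ) with hu
  have h1 : quad A u = A⁻¹ j j := by
    rw [quad, dotProduct_mulVec_inv_single hA, hu]
    simp
  rw [← integral_const_mul,
    ← integral_sub_right_eq_self (fun θ => Real.exp (t ^ 2 / (4 * s) * A⁻¹ j j) *
      Real.exp (-(s * quad A θ))) ((t / (2 * s)) • u)]
  refine integral_congr_ae (Filter.Eventually.of_forall fun θ => ?_)
  simp only
  rw [← Real.exp_add, sub_eq_add_neg, ← neg_smul, quad_add_smul hA, h1, hu,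
    dotProduct_mulVec_inv_single hA]
  congr 1
  field_simp
  ring

lemma integral_exp_neg_mul_quad (A : Matrix (Fin n) (Fin n) ℝ) {s : ℝ} (hs : 0 < s) :
    ∫ θ, Real.exp (-(s * quad A θ)) = (Real.sqrt s ^ n)⁻¹ * ∫ θ, Real.exp (-quad A θ) := by
  have h := Measure.integral_comp_smul (volume : Measure (Fin n → ℝ))
    (fun θ => Real.exp (-quad A θ)) (Real.sqrt s)
  simp only [quad_smul, Real.sq_sqrt hs.le, Module.finrank_fin_fun, smul_eq_mul] at h
  rw [h, abs_of_nonneg (by positivity)]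

/-- Chernoff and a union bound over the `2n` half-spaces `±θ_j > ρ`. With `s ≥ 1/2` the exponent is
at most `-tρ + t²b/2`, which `t = ρ/b` minimises to `-ρ²/(2b)`. -/
lemma setIntegral_compl_cube_le {b : ℝ} (hb : 0 < b) {A : Matrix (Fin n) (Fin n) ℝ}
    (hA : A.PosDef) (hinv : specNorm A⁻¹ ≤ b) (hdiag : ∀ j, A⁻¹ j j ≤ b) {s : ℝ}
    (hs : 1 / 2 ≤ s) {ρ : ℝ} (hρ : 0 ≤ ρ) :
    ∫ θ in (cube n ρ)ᶜ, Real.exp (-(s * quad A θ)) ≤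
      2 * n * Real.exp (-(ρ ^ 2 / (2 * b))) * ∫ θ, Real.exp (-(s * quad A θ)) := by
  have hs0 : 0 < s := by linarith
  set t := ρ / b with ht
  have ht0 : 0 ≤ t := by positivity
  set G := ∫ θ, Real.exp (-(s * quad A θ)) with hG
  have hG0 : 0 ≤ G := integral_nonneg fun θ => (Real.exp_pos _).le
  rw [← integral_indicator (measurableSet_cube n ρ).compl]
  have hint : ∀ (t : ℝ) (j : Fin n),
      Integrable (fun θ => Real.exp (-(s * quad A θ) + t * θ j)) :=
    fun t j => integrable_exp_neg_quad_add hb hA hinv hs0 t j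
  calc ∫ θ, (cube n ρ)ᶜ.indicator (fun θ => Real.exp (-(s * quad A θ))) θ
      ≤ ∫ θ, ∑ j, Real.exp (-(t * ρ)) * (Real.exp (-(s * quad A θ) + t * θ j) +
          Real.exp (-(s * quad A θ) + -t * θ j)) := by
        refine integral_mono
          ((integrable_exp_neg_quad hb hA hinv hs0).indicator (measurableSet_cube n ρ).compl)
          (integrable_finsetSum _ fun j _ => ((hint t j).add (hint (-t) j)).const_mul _)
          fun θ => ?_
        have hpos : ∀ j ∈ Finset.univ, 0 ≤ Real.exp (-(t * ρ)) *
            (Real.exp (-(s * quad A θ) + t * θ j) + Real.exp (-(s * quad A θ) + -t * θ j)) :=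
          fun j _ => by positivity
        by_cases hθ : θ ∈ cube n ρ
        · rw [Set.indicator_of_notMem (by simpa using hθ)]
          exact Finset.sum_nonneg hpos
        · rw [Set.indicator_of_mem (by simpa using hθ)]
          simp only [cube, Set.mem_ofPred_eq, not_forall, not_le] at hθ
          obtain ⟨j, hj⟩ := hθ
          refine le_trans ?_ (Finset.single_le_sum hpos (Finset.mem_univ j))
          rw [mul_add, ← Real.exp_add, ← Real.exp_add]
          rcases le_abs'.1 hj.le with h | h
          · have : Real.exp (-(s * quad A θ)) ≤
                Real.exp (-(t * ρ) + (-(s * quad A θ) + -t * θ j)) := by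
              rw [Real.exp_le_exp]
              nlinarith
            have := (Real.exp_pos (-(t * ρ) + (-(s * quad A θ) + t * θ j))).le
            linarith
          · have : Real.exp (-(s * quad A θ)) ≤
                Real.exp (-(t * ρ) + (-(s * quad A θ) + t * θ j)) := by
              rw [Real.exp_le_exp]
              nlinarith
            have := (Real.exp_pos (-(t * ρ) + (-(s * quad A θ) + -t * θ j))).le
            linarith
    _ = ∑ j : Fin n, Real.exp (-(t * ρ)) * (2 * (Real.exp (t ^ 2 / (4 * s) * A⁻¹ j j) * G)) := by
        have hint2 : ∀ j ∈ Finset.univ, Integrable (fun θ => Real.exp (-(t * ρ)) *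
            (Real.exp (-(s * quad A θ) + t * θ j) + Real.exp (-(s * quad A θ) + -t * θ j))) :=
          fun j _ => ((hint t j).add (hint (-t) j)).const_mul _
        rw [integral_finsetSum _ hint2]
        refine Finset.sum_congr rfl fun j _ => ?_
        rw [integral_const_mul, integral_add (hint t j) (hint (-t) j),
          integral_exp_neg_quad_add hA hs0, integral_exp_neg_quad_add hA hs0, neg_sq]
        ring
    _ ≤ ∑ _j : Fin n, Real.exp (-(t * ρ)) * (2 * (Real.exp (t ^ 2 / 2 * b) * G)) := by
        refine Finset.sum_le_sum fun j _ => ?_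
        have h1 : t ^ 2 / (4 * s) ≤ t ^ 2 / 2 :=
          div_le_div_of_nonneg_left (sq_nonneg _) (by norm_num) (by linarith)
        have h2 : t ^ 2 / (4 * s) * A⁻¹ j j ≤ t ^ 2 / 2 * b :=
          (mul_le_mul_of_nonneg_left (hdiag j) (by positivity)).trans
            (mul_le_mul_of_nonneg_right h1 hb.le)
        gcongr
    _ = 2 * n * Real.exp (-(ρ ^ 2 / (2 * b))) * G := by
        have : Real.exp (-(ρ ^ 2 / (2 * b))) = Real.exp (-(t * ρ)) * Real.exp (t ^ 2 / 2 * b) := by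
          rw [← Real.exp_add, ht]
          congr 1
          field_simp
          ring
        rw [this]
        simp
        ring

/-! ### Domination of `e^F` by a Gaussian of comparable mass -/

lemma inv_sqrt_pow_le_exp {c : ℝ} (hc : 0 ≤ c) (hn : 0 < n) (hcn : c / n ≤ 1 / 2) :
    (Real.sqrt (1 - c / n) ^ n)⁻¹ ≤ Real.exp c := by
  have hn' : (0 : ℝ) < n := by exact_mod_cast hn
  set x := c / n with hx
  have hx0 : 0 ≤ x := by positivity
  have h1 : Real.exp (-(2 * x)) ≤ 1 - x := by
    rw [Real.exp_neg]
    refine inv_le_of_inv_le₀ (by linarith) ?_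
    refine le_trans ?_ (Real.add_one_le_exp _)
    rw [inv_le_iff_one_le_mul₀ (by linarith)]
    nlinarith
  have h2 : Real.exp (-x) ≤ Real.sqrt (1 - x) := by
    refine Real.le_sqrt_of_sq_le ?_
    rwa [← Real.exp_nat_mul, Nat.cast_ofNat, mul_neg]
  have h3 : Real.exp (-c) ≤ Real.sqrt (1 - x) ^ n := by
    have : Real.exp (-c) = Real.exp (-x) ^ n := by
      rw [← Real.exp_nat_mul, hx]
      congr 1
      field_simp
    rw [this]
    gcongr
  rw [← neg_neg c, Real.exp_neg (-c)]
  exact inv_anti₀ (Real.exp_pos _) h3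

lemma gaussMass_eq (A : Matrix (Fin n) (Fin n) ℝ) :
    gaussMass A = ∫ θ, Real.exp (-quad A θ) := by
  simp [gaussMass, bracket, action]

lemma gaussMass_nonneg (A : Matrix (Fin n) (Fin n) ℝ) : 0 ≤ gaussMass A := by
  rw [gaussMass_eq]
  exact integral_nonneg fun θ => (Real.exp_pos _).le

lemma continuous_action {c₁ c₂ : ℝ} {A : Matrix (Fin n) (Fin n) ℝ} {H : (Fin n → ℝ) → ℝ}
    (hH : IsPerturbation c₁ c₂ A H) : Continuous (action A H) :=
  (continuous_quad A).neg.add hH.differentiable.continuous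

/-- For `n ≥ 2c₁` the bound on `H` gives `s = 1 - c₁/n`, and rescaling costs the factor `(1 -
c₁/n)^(-n/2) ≤ e^{c₁}`. For smaller `n` this `s` could fail to be positive; but then the cube has
bounded size, so `H ≤ K` on it and `s = 1` works. -/
lemma exists_exp_action_le (a b ε r c₁ : ℝ) (ha : 0 < a) (hε : 0 < ε) (hr : 0 < r)
    (hc₁ : 0 < c₁) : ∃ M : ℝ, 1 ≤ M ∧ ∀ (n : ℕ), 0 < n → ∀ (c₂ : ℝ)
      (A : Matrix (Fin n) (Fin n) ℝ) (H : (Fin n → ℝ) → ℝ), IsAdmissible a b A →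
      IsPerturbation c₁ c₂ A H → ∃ s : ℝ, 1 / 2 ≤ s ∧
        (∀ θ ∈ cube n (r * (n : ℝ) ^ ε),
          Real.exp (action A H θ) ≤ M * Real.exp (-(s * quad A θ))) ∧
        ∫ θ, Real.exp (-(s * quad A θ)) ≤ M * gaussMass A := by
  set K := c₁ * ((1 + a) * (r * (2 * c₁) ^ ε) ^ 2) with hK
  have hK0 : 0 ≤ K := by positivity
  refine ⟨Real.exp (K + c₁), Real.one_le_exp (by linarith), ?_⟩
  intro n hn c₂ A H hA hH
  have hn' : (0 : ℝ) < n := by exact_mod_cast hn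
  have hG := gaussMass_nonneg A
  by_cases hcn : c₁ / n ≤ 1 / 2
  · refine ⟨1 - c₁ / n, by linarith, fun θ _ => ?_, ?_⟩
    · rw [← Real.exp_add, Real.exp_le_exp]
      have h1 := hH.le_quad θ
      have h2 : c₁ * quad A θ / n = c₁ / n * quad A θ := by ring
      unfold action
      nlinarith
    · rw [integral_exp_neg_mul_quad A (by linarith), gaussMass_eq]
      have h1 := inv_sqrt_pow_le_exp hc₁.le hn hcn
      have h2 : Real.exp c₁ ≤ Real.exp (K + c₁) := Real.exp_le_exp.2 (by linarith)
      rw [gaussMass_eq] at hG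
      exact mul_le_mul_of_nonneg_right (h1.trans h2) hG
  · refine ⟨1, by norm_num, fun θ hθ => ?_, ?_⟩
    · rw [← Real.exp_add, Real.exp_le_exp]
      rw [mem_cube_iff_norm_le (by positivity)] at hθ
      have hnc : (n : ℝ) ≤ 2 * c₁ := by
        rw [not_le, lt_div_iff₀ hn'] at hcn
        linarith
      have h1 := hH.le_quad θ
      have h2 : c₁ * quad A θ / n ≤ c₁ * ((1 + a) * ‖θ‖ ^ 2) := by
        rw [div_le_iff₀ hn']
        have := mul_le_mul_of_nonneg_left (hA.quad_le ha θ) hc₁.le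
        linarith
      have h3 : ‖θ‖ ≤ r * (2 * c₁) ^ ε := hθ.trans (by gcongr)
      have h4 : c₁ * ((1 + a) * ‖θ‖ ^ 2) ≤ K := by
        rw [hK]
        gcongr
      unfold action
      linarith
    · simp only [one_mul]
      rw [← gaussMass_eq]
      exact le_mul_of_one_le_left hG (Real.one_le_exp (by linarith))

/-! ### Cutoff and integration by parts -/

/-- A product of one-dimensional bumps in `θ_j/ρ`. Each partial derivative hits one factor while the
others stay in `[0,1]`, so the constant does not depend on `n` when `v` is measured in `ℓ¹`. -/
lemma exists_cutoff : ∃ K : ℝ, 0 < K ∧ ∀ (n : ℕ) (ρ : ℝ), 0 < ρ →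
    ∃ χ : (Fin n → ℝ) → ℝ, ContDiff ℝ 1 χ ∧ (∀ θ, 0 ≤ χ θ) ∧ (∀ θ, χ θ ≤ 1) ∧
      (∀ θ ∈ cube n (ρ / 2), χ θ = 1) ∧ (∀ θ ∉ cube n ρ, χ θ = 0) ∧
      ∀ θ v, |fderiv ℝ χ θ v| ≤ K / ρ * ∑ j, |v j| := by
  let ψ : ContDiffBump (0 : ℝ) := ⟨1 / 2, 1, by norm_num, by norm_num⟩
  have hψ : ContDiff ℝ 1 ψ := ψ.contDiff
  obtain ⟨K, hK⟩ := ψ.hasCompactSupport.deriv.exists_bound_of_continuous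
    (hψ.continuous_deriv le_rfl)
  refine ⟨|K| + 1, by positivity, fun n ρ hρ => ?_⟩
  refine ⟨fun θ => ∏ j, ψ (ρ⁻¹ * θ j), ?_, fun θ => Finset.prod_nonneg fun j _ => ψ.nonneg,
    fun θ => Finset.prod_le_one (fun j _ => ψ.nonneg) fun j _ => ψ.le_one, ?_, ?_, ?_⟩
  · exact contDiff_prod fun j _ => hψ.comp (by fun_prop)
  · intro θ hθ
    refine Finset.prod_eq_one fun j _ => ψ.one_of_mem_closedBall ?_
    rw [mem_closedBall_zero_iff, Real.norm_eq_abs, abs_mul, abs_of_pos (inv_pos.2 hρ)]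
    have := hθ j
    change _ ≤ (1 / 2 : ℝ)
    rw [inv_mul_le_iff₀ hρ]
    linarith
  · intro θ hθ
    simp only [cube, Set.mem_ofPred_eq, not_forall, not_le] at hθ
    obtain ⟨j, hj⟩ := hθ
    refine Finset.prod_eq_zero (Finset.mem_univ j) (ψ.zero_of_le_dist ?_)
    rw [dist_zero_right, Real.norm_eq_abs, abs_mul, abs_of_pos (inv_pos.2 hρ)]
    change (1 : ℝ) ≤ _
    rw [le_inv_mul_iff₀ hρ]
    linarith
  · intro θ v
    have hd : ∀ j ∈ Finset.univ, HasFDerivAt (fun θ : Fin n → ℝ => ψ (ρ⁻¹ * θ j))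
        (deriv ψ (ρ⁻¹ * θ j) • (ρ⁻¹ • ContinuousLinearMap.proj (R := ℝ) (φ := fun _ => ℝ) j)) θ := by
      intro j _
      have h1 : HasFDerivAt (fun θ : Fin n → ℝ => ρ⁻¹ * θ j)
          (ρ⁻¹ • ContinuousLinearMap.proj (R := ℝ) (φ := fun _ => ℝ) j) θ :=
        (ContinuousLinearMap.proj (R := ℝ) (φ := fun _ : Fin n => ℝ) j).hasFDerivAt.const_mul ρ⁻¹
      exact (hψ.differentiable one_ne_zero _).hasDerivAt.comp_hasFDerivAt θ h1
    rw [(HasFDerivAt.finsetProd hd).fderiv]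
    simp only [sum_apply, smul_apply,
      ContinuousLinearMap.proj_apply, smul_eq_mul]
    rw [Finset.mul_sum]
    refine (Finset.abs_sum_le_sum_abs _ _).trans (Finset.sum_le_sum fun j _ => ?_)
    have h1 : |∏ i ∈ Finset.univ.erase j, ψ (ρ⁻¹ * θ i)| ≤ 1 := by
      rw [abs_of_nonneg (Finset.prod_nonneg fun i _ => ψ.nonneg)]
      exact Finset.prod_le_one (fun i _ => ψ.nonneg) fun i _ => ψ.le_one
    have h2 : |deriv ψ (ρ⁻¹ * θ j)| ≤ |K| + 1 := by
      have := hK (ρ⁻¹ * θ j)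
      rw [Real.norm_eq_abs] at this
      linarith [le_abs_self K]
    rw [abs_mul, abs_mul, abs_mul, abs_of_pos (inv_pos.2 hρ)]
    calc _ ≤ 1 * ((|K| + 1) * (ρ⁻¹ * |v j|)) := by gcongr
      _ = _ := by ring

lemma integral_eq_zero_of_hasLineDerivAt {E : Type} [NormedAddCommGroup E] [NormedSpace ℝ E]
    {u u' : (Fin n → ℝ) → E} {v : Fin n → ℝ} (hu : Integrable u) (hu' : Integrable u')
    (h : ∀ θ, HasLineDerivAt ℝ u (u' θ) θ v) : ∫ θ, u' θ = 0 := by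
  have := integral_bilinear_hasLineDerivAt_right_eq_neg_left_of_integrable
    (μ := (volume : Measure (Fin n → ℝ))) (f := fun _ => (1 : ℝ)) (f' := fun _ => (0 : ℝ))
    (g := u) (g' := u') (v := v) (B := ContinuousLinearMap.lsmul ℝ ℝ)
    (by simp) (by simpa using hu') (by simpa using hu)
    (fun x _ => hasDerivAt_const (0 : ℝ) (1 : ℝ)) (fun x _ => h x)
  simpa using this

lemma integrable_exp_action {c₁ c₂ : ℝ} {A : Matrix (Fin n) (Fin n) ℝ} {H : (Fin n → ℝ) → ℝ}
    (hH : IsPerturbation c₁ c₂ A H) {Ω : Set (Fin n → ℝ)} {R : ℝ} (hR : 0 ≤ R)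
    (hΩ : Ω ⊆ cube n R) {E : Type} [NormedAddCommGroup E] [NormedSpace ℝ E]
    {g : (Fin n → ℝ) → E} (hg : Continuous g) :
    IntegrableOn (fun θ => Real.exp (action A H θ) • g θ) Ω := by
  have := continuous_action hH
  have hc : Continuous fun θ => Real.exp (action A H θ) • g θ := by fun_prop
  refine (hc.continuousOn.integrableOn_compact (K := Metric.closedBall 0 R)
    (isCompact_closedBall _ _)).mono_set fun θ hθ => ?_
  rw [mem_closedBall_zero_iff]
  exact (mem_cube_iff_norm_le hR θ).1 (hΩ hθ)

/-- Integrate the `v`-derivative of `u = e^F χ g`, with `χ` supported in the inner cube, and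
subtract this zero from the bracket. Where `χ = 1` only the `∂_v H` term is left; the other errors
live outside the half cube, where the mass is small. -/
lemma exists_norm_bracket_le : ∃ K : ℝ, 0 < K ∧ ∀ (n : ℕ) (c₁ c₂ : ℝ)
    (A : Matrix (Fin n) (Fin n) ℝ) (H : (Fin n → ℝ) → ℝ) (Ω : Set (Fin n → ℝ)) (ρ R L : ℝ)
    (k : Fin n), A.PosDef → IsPerturbation c₁ c₂ A H → NullMeasurableSet Ω volume → 0 < ρ →
    0 ≤ R → 0 ≤ L → cube n ρ ⊆ Ω → Ω ⊆ cube n R →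
    (∀ θ ∈ cube n ρ, |fderiv ℝ H θ (A⁻¹ *ᵥ Pi.single k 1)| ≤ L) →
    ∀ (E : Type) [NormedAddCommGroup E] [NormedSpace ℝ E] (g g' : (Fin n → ℝ) → E) (G₀ G₁ : ℝ),
    Continuous g → Continuous g' →
    (∀ θ, HasLineDerivAt ℝ g (g' θ) θ (A⁻¹ *ᵥ Pi.single k 1)) →
    (∀ θ ∈ Ω, ‖g θ‖ ≤ G₀) → (∀ θ ∈ Ω, ‖g' θ‖ ≤ G₁) →
    ‖bracket (action A H) Ω (fun θ => g' θ - (2 * θ k) • g θ)‖ ≤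
      (G₀ * L * ∫ θ in Ω, Real.exp (action A H θ)) +
      (G₁ + 2 * R * G₀ + K / ρ * (∑ j, |A⁻¹ j k|) * G₀) *
        ∫ θ in Ω ∩ (cube n (ρ / 2))ᶜ, Real.exp (action A H θ) := by
  obtain ⟨K, hK, hcut⟩ := exists_cutoff
  refine ⟨K, hK, ?_⟩
  intro n c₁ c₂ A H Ω ρ R L k hA hH hΩm hρ hR hL hρΩ hΩR hHL E _ _ g g' G₀ G₁ hg hg' hgd hG₀ hG₁
  obtain ⟨χ, hχ, hχ0, hχ1, hχin, hχout, hχd⟩ := hcut n ρ hρ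
  set v := A⁻¹ *ᵥ Pi.single k (1 : ℝ) with hv
  have hvj : ∀ j, v j = A⁻¹ j k := fun j => by simp [hv]
  set w := fun θ => Real.exp (action A H θ) with hw
  have hwc : Continuous w := Real.continuous_exp.comp (continuous_action hH)
  have hχc : Continuous χ := hχ.continuous
  have hχdiff : Differentiable ℝ χ := hχ.differentiable one_ne_zero
  have hχ'c : Continuous fun θ => fderiv ℝ χ θ v :=
    (hχ.continuous_fderiv one_ne_zero).clm_apply continuous_const
  -- Every such point is a global maximum of `χ`, so its derivative vanishes even on the boundary of
  -- the cube; likewise for minima below.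
  have hχ'in : ∀ θ ∈ cube n (ρ / 2), fderiv ℝ χ θ v = 0 := fun θ hθ => by
    have : IsLocalMax χ θ := Filter.Eventually.of_forall fun x => by
      rw [hχin θ hθ]
      exact hχ1 x
    rw [this.fderiv_eq_zero]
    rfl
  have hχ'out : ∀ θ ∉ cube n ρ, fderiv ℝ χ θ v = 0 := fun θ hθ => by
    have : IsLocalMin χ θ := Filter.Eventually.of_forall fun x => by
      rw [hχout θ hθ]
      exact hχ0 x
    rw [this.fderiv_eq_zero]
    rfl
  have hG₀0 : 0 ≤ G₀ := (norm_nonneg _).trans (hG₀ 0 (hρΩ fun j => by simp [hρ.le]))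
  have hcs : ∀ {f : (Fin n → ℝ) → E}, (∀ θ ∉ cube n ρ, f θ = 0) → HasCompactSupport f := by
    intro f hf
    refine HasCompactSupport.intro (K := Metric.closedBall 0 ρ) (isCompact_closedBall _ _)
      fun θ hθ => hf θ ?_
    rwa [mem_cube_iff_norm_le hρ.le, ← mem_closedBall_zero_iff]
  set u := fun θ => (w θ * χ θ) • g θ with hu
  -- The derivative of `u` is split in two: `h₁` is continuous, while `h₂` contains the derivative
  -- of `H`, which is only known to be measurable and bounded by `L` on the inner cube.
  set h₁ := fun θ => (w θ * χ θ) • (g' θ - (2 * θ k) • g θ) + (w θ * fderiv ℝ χ θ v) • g θ with hh₁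
  set h₂ := fun θ => fderiv ℝ H θ v • u θ with hh₂
  have hui : Integrable u := Continuous.integrable_of_hasCompactSupport (by fun_prop)
    (hcs fun θ hθ => by simp [hu, hχout θ hθ])
  have hh₁i : Integrable h₁ := Continuous.integrable_of_hasCompactSupport (by fun_prop)
    (hcs fun θ hθ => by simp [hh₁, hχout θ hθ, hχ'out θ hθ])
  have hh₂le : ∀ θ, ‖h₂ θ‖ ≤ L * ‖u θ‖ := fun θ => by
    rw [hh₂, norm_smul, Real.norm_eq_abs]
    by_cases hθ : θ ∈ cube n ρ
    · exact mul_le_mul_of_nonneg_right (hHL θ hθ) (norm_nonneg _)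
    · simp [hu, hχout θ hθ]
  have hh₂i : Integrable h₂ := by
    refine (hui.norm.const_mul L).mono' ?_ (Filter.Eventually.of_forall hh₂le)
    exact (measurable_fderiv_apply_const ℝ H v).aestronglyMeasurable.smul hui.aestronglyMeasurable
  have hderiv : ∀ θ, HasLineDerivAt ℝ u (h₁ θ + h₂ θ) θ v := by
    intro θ
    have e1 : HasDerivAt (fun t : ℝ => action A H (θ + t • v)) (-(2 * θ k) + fderiv ℝ H θ v) 0 := by
      have q := hasLineDerivAt_quad hA θ v
      rw [hv, dotProduct_mulVec_inv_single hA, ← hv] at q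
      exact HasDerivAt.add (HasDerivAt.neg q)
        ((hH.differentiable θ).hasFDerivAt.hasLineDerivAt v)
    have e2 : HasDerivAt (fun t : ℝ => χ (θ + t • v)) (fderiv ℝ χ θ v) 0 :=
      (hχdiff θ).hasFDerivAt.hasLineDerivAt v
    have e3 := (e1.exp.mul e2).smul (hgd θ)
    refine e3.congr_deriv ?_
    simp only [zero_smul, add_zero, Pi.mul_apply, hh₁, hh₂, hu, hw]
    module
  have hzero : ∫ θ, (h₁ θ + h₂ θ) = 0 :=
    integral_eq_zero_of_hasLineDerivAt hui (hh₁i.add hh₂i) hderiv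
  have hzeroΩ : ∫ θ in Ω, (h₁ θ + h₂ θ) = 0 := by
    rw [setIntegral_eq_integral_of_forall_compl_eq_zero, hzero]
    intro θ hθ
    have hθ' : θ ∉ cube n ρ := fun h => hθ (hρΩ h)
    simp [hh₁, hh₂, hu, hχout θ hθ', hχ'out θ hθ']
  have hφi : IntegrableOn (fun θ => w θ • (g' θ - (2 * θ k) • g θ)) Ω :=
    integrable_exp_action hH hR hΩR (by fun_prop)
  have hbr : bracket (action A H) Ω (fun θ => g' θ - (2 * θ k) • g θ) =
      ∫ θ in Ω, (w θ • (g' θ - (2 * θ k) • g θ) - (h₁ θ + h₂ θ)) := by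
    have hh : IntegrableOn (fun θ => h₁ θ + h₂ θ) Ω := (hh₁i.add hh₂i).integrableOn
    rw [integral_sub hφi hh, hzeroΩ, sub_zero]
    rfl
  have hwi : IntegrableOn w Ω := by
    simpa using integrable_exp_action hH hR hΩR (continuous_const (y := (1 : ℝ)))
  set D := G₁ + 2 * R * G₀ + K / ρ * (∑ j, |A⁻¹ j k|) * G₀ with hD
  have hcm := (measurableSet_cube n (ρ / 2)).compl
  have hbound : ∀ θ ∈ Ω, ‖w θ • (g' θ - (2 * θ k) • g θ) - (h₁ θ + h₂ θ)‖ ≤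
      G₀ * L * w θ + (cube n (ρ / 2))ᶜ.indicator (fun θ => D * w θ) θ := by
    intro θ hθ
    have hw0 : 0 ≤ w θ := (Real.exp_pos _).le
    have hh₂' : ‖h₂ θ‖ ≤ G₀ * L * w θ := by
      refine (hh₂le θ).trans ?_
      rw [hu, norm_smul, Real.norm_eq_abs, abs_mul, abs_of_nonneg hw0, abs_of_nonneg (hχ0 θ)]
      calc L * (w θ * χ θ * ‖g θ‖) ≤ L * (w θ * 1 * G₀) := by
            have := hχ1 θ
            have := hG₀ θ hθ
            gcongr
        _ = _ := by ring
    by_cases hc : θ ∈ cube n (ρ / 2)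
    · rw [Set.indicator_of_notMem (by simpa using hc), add_zero]
      have : w θ • (g' θ - (2 * θ k) • g θ) - (h₁ θ + h₂ θ) = -h₂ θ := by
        simp [hh₁, hχin θ hc, hχ'in θ hc]
      rw [this, norm_neg]
      exact hh₂'
    · rw [Set.indicator_of_mem (by simpa using hc)]
      have e : w θ • (g' θ - (2 * θ k) • g θ) - (h₁ θ + h₂ θ) =
          (w θ * (1 - χ θ)) • (g' θ - (2 * θ k) • g θ) - (w θ * fderiv ℝ χ θ v) • g θ - h₂ θ := by
        simp only [hh₁]
        module
      rw [e]
      have i1 : ‖(w θ * (1 - χ θ)) • (g' θ - (2 * θ k) • g θ)‖ ≤ w θ * (G₁ + 2 * R * G₀) := by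
        rw [norm_smul, Real.norm_eq_abs, abs_mul, abs_of_nonneg hw0,
          abs_of_nonneg (sub_nonneg.2 (hχ1 θ))]
        have j1 : ‖g' θ - (2 * θ k) • g θ‖ ≤ G₁ + 2 * R * G₀ := by
          refine (norm_sub_le _ _).trans (add_le_add (hG₁ θ hθ) ?_)
          rw [norm_smul, Real.norm_eq_abs, abs_mul, abs_two]
          have := hG₀ θ hθ
          have := hΩR hθ k
          gcongr
        have j2 : 1 - χ θ ≤ 1 := by linarith [hχ0 θ]
        calc w θ * (1 - χ θ) * ‖g' θ - (2 * θ k) • g θ‖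
            ≤ w θ * 1 * (G₁ + 2 * R * G₀) := by gcongr
          _ = _ := by ring
      have i2 : ‖(w θ * fderiv ℝ χ θ v) • g θ‖ ≤ w θ * (K / ρ * (∑ j, |A⁻¹ j k|) * G₀) := by
        rw [norm_smul, Real.norm_eq_abs, abs_mul, abs_of_nonneg hw0, mul_assoc]
        have j1 := hχd θ v
        simp only [hvj] at j1
        have := hG₀ θ hθ
        gcongr
      have i3 := norm_sub_le ((w θ * (1 - χ θ)) • (g' θ - (2 * θ k) • g θ) -
        (w θ * fderiv ℝ χ θ v) • g θ) (h₂ θ)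
      have i4 := norm_sub_le ((w θ * (1 - χ θ)) • (g' θ - (2 * θ k) • g θ))
        ((w θ * fderiv ℝ χ θ v) • g θ)
      rw [hD]
      linarith
  rw [hbr]
  have hi1 : IntegrableOn (fun θ => G₀ * L * w θ) Ω := hwi.const_mul _
  have hi2 : IntegrableOn ((cube n (ρ / 2))ᶜ.indicator (fun θ => D * w θ)) Ω :=
    IntegrableOn.indicator (hwi.const_mul _) hcm
  refine (norm_integral_le_of_norm_le (hi1.add hi2) ?_).trans_eq ?_
  · filter_upwards [ae_restrict_mem₀ hΩm] with θ hθ using hbound θ hθ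
  · simp only [Pi.add_apply]
    rw [integral_add hi1 hi2, setIntegral_indicator hcm, integral_const_mul, integral_const_mul]

/-! ### Uniform constants: mass, tails and the Stein bound -/

lemma exists_pow_mul_exp_le {δ c : ℝ} (hδ : 0 < δ) (hc : 0 < c) (q : ℕ) :
    ∃ C : ℝ, 0 < C ∧ ∀ x : ℝ, 1 ≤ x → x ^ q * Real.exp (-(c * x ^ δ)) ≤ C := by
  obtain ⟨m, hm⟩ := exists_nat_ge (q / δ)
  refine ⟨m.factorial / c ^ m, by positivity, fun x hx => ?_⟩
  have hx0 : 0 < x := by linarith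
  have h1 : x ^ q ≤ (x ^ δ) ^ m := by
    rw [← Real.rpow_natCast, ← Real.rpow_natCast, ← Real.rpow_mul hx0.le]
    refine Real.rpow_le_rpow_of_exponent_le hx ?_
    rw [div_le_iff₀ hδ] at hm
    linarith
  have h2 := Real.pow_div_factorial_le_exp (x := c * x ^ δ) (by positivity) m
  rw [Real.exp_neg, ← div_eq_mul_inv, div_le_iff₀ (Real.exp_pos _)]
  refine h1.trans ?_
  rw [mul_pow, div_le_iff₀ (by positivity)] at h2
  rw [div_mul_eq_mul_div, le_div_iff₀ (by positivity)]
  linarith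

lemma fderiv_apply_eq_sum_grad (H : (Fin n → ℝ) → ℝ) (θ v : Fin n → ℝ) :
    fderiv ℝ H θ v = ∑ j, v j * grad H θ j := by
  conv_lhs => rw [← Finset.univ_sum_single v]
  rw [map_sum]
  refine Finset.sum_congr rfl fun j _ => ?_
  have : Pi.single j (v j) = v j • Pi.single j (1 : ℝ) := by
    rw [← Pi.single_smul, smul_eq_mul, mul_one]
  rw [this, map_smul]
  rfl

lemma abs_fderiv_le {c₁ c₂ : ℝ} (hc₂ : 0 < c₂) {A : Matrix (Fin n) (Fin n) ℝ}
    {H : (Fin n → ℝ) → ℝ} (hH : IsPerturbation c₁ c₂ A H) {ρ : ℝ} {θ : Fin n → ℝ}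
    (hθ : ‖θ‖ ≤ ρ) (v : Fin n → ℝ) :
    |fderiv ℝ H θ v| ≤ (∑ j, |v j|) * (c₂ * (ρ ^ 3 + ρ) / n) := by
  rw [fderiv_apply_eq_sum_grad, Finset.sum_mul]
  refine (Finset.abs_sum_le_sum_abs _ _).trans (Finset.sum_le_sum fun j _ => ?_)
  rw [abs_mul]
  refine mul_le_mul_of_nonneg_left ?_ (abs_nonneg _)
  refine (norm_le_pi_norm (grad H θ) j).trans ((hH.grad_le θ).trans ?_)
  gcongr

/-- Approximate Gaussian integration by parts along the `k`-th column of `A⁻¹`, for all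
differentiable observables that are bounded on `Ω`. -/
def SteinBound (C N : ℝ) (A : Matrix (Fin n) (Fin n) ℝ) (H : (Fin n → ℝ) → ℝ)
    (Ω : Set (Fin n → ℝ)) : Prop :=
  ∀ (k : Fin n) (E : Type) [NormedAddCommGroup E] [NormedSpace ℝ E]
    (g g' : (Fin n → ℝ) → E) (G₀ G₁ : ℝ), Continuous g → Continuous g' →
    (∀ θ, HasLineDerivAt ℝ g (g' θ) θ (A⁻¹ *ᵥ Pi.single k 1)) →
    (∀ θ ∈ Ω, ‖g θ‖ ≤ G₀) → (∀ θ ∈ Ω, ‖g' θ‖ ≤ G₁) →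
    ‖bracket (action A H) Ω (fun θ => g' θ - (2 * θ k) • g θ)‖ ≤
      C * ((G₀ * N ^ 3 + G₁) / n) * gaussMass A

/-- Domination and tail bounds are fed into the cutoff identity with `ρ = r₁N` and `R = r₂N`. -/
lemma exists_bracket_bounds (a b ε r₁ r₂ c₁ c₂ : ℝ) (ha : 0 < a) (hb : 0 < b) (hε : 0 < ε)
    (hr₁ : 0 < r₁) (hr₂ : r₁ < r₂) (hc₁ : 0 < c₁) (hc₂ : 0 < c₂) :
    ∃ C c₃ : ℝ, 0 < C ∧ 0 < c₃ ∧ ∀ (n : ℕ), 0 < n →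
      ∀ (A : Matrix (Fin n) (Fin n) ℝ) (H : (Fin n → ℝ) → ℝ) (Ω : Set (Fin n → ℝ)),
      IsAdmissible a b A → IsPerturbation c₁ c₂ A H → NullMeasurableSet Ω volume →
      cube n (r₁ * (n : ℝ) ^ ε) ⊆ Ω → Ω ⊆ cube n (r₂ * (n : ℝ) ^ ε) →
      |bracket (action A 0) Ω (fun _ => (1 : ℝ)) - gaussMass A|
          ≤ C * Real.exp (-c₃ * (n : ℝ) ^ (2 * ε)) * gaussMass A ∧
      ∫ θ in Ω, Real.exp (action A H θ) ≤ C * gaussMass A ∧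
      SteinBound C ((n : ℝ) ^ ε) A H Ω := by
  have hr₂0 : 0 < r₂ := hr₁.trans hr₂
  obtain ⟨M, hM, hdom⟩ := exists_exp_action_le a b ε r₂ c₁ ha hε hr₂0 hc₁
  obtain ⟨K, hK, hstein⟩ := exists_norm_bracket_le
  -- The tail exponent at radius `r₁N/2` is `r₁²N²/(8b) = 2c₃N²`: one half absorbs powers of `n`,
  -- the other half is what remains in the first claim.
  set c₃ := r₁ ^ 2 / (16 * b) with hc₃
  have hc₃0 : 0 < c₃ := by positivity
  -- The power is 2 because one factor `n` comes from the union bound and another is needed to leave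
  -- `1/n` in the tail term.
  obtain ⟨C₁, hC₁, hexp⟩ := exists_pow_mul_exp_le (δ := 2 * ε) (c := c₃) (by positivity) hc₃0 2
  set S := 1 + (a + a ^ 2 * b) with hS
  have hS0 : 0 < S := by positivity
  set L₀ := S * (c₂ * (r₁ ^ 3 + r₁)) with hL₀
  have hL₀0 : 0 < L₀ := by positivity
  set T₀ := 2 * M ^ 2 * C₁ with hT₀
  have hM0 : 0 < M := by linarith
  have hT₀0 : 0 < T₀ := by positivity
  set C := 2 * C₁ + M ^ 2 + (L₀ * M ^ 2 + (1 + 2 * r₂ + K / r₁ * S) * T₀) with hC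
  refine ⟨C, c₃, by positivity, hc₃0, ?_⟩
  intro n hn A H Ω hA hH hΩm hΩ₁ hΩ₂
  have hn' : (0 : ℝ) < n := by exact_mod_cast hn
  have hn1 : (1 : ℝ) ≤ n := by exact_mod_cast hn
  have hN1 : 1 ≤ (n : ℝ) ^ ε := Real.one_le_rpow hn1 hε.le
  have hN2 : (n : ℝ) ^ (2 * ε) = ((n : ℝ) ^ ε) ^ 2 := by
    rw [← Real.rpow_natCast, ← Real.rpow_mul hn'.le, mul_comm 2 ε, Nat.cast_ofNat]
  have hexpn := hexp n hn1
  rw [hN2] at hexpn ⊢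
  set N := (n : ℝ) ^ ε with hN
  have hN0 : 0 < N := by linarith
  set G := gaussMass A with hG
  have hG0 : 0 ≤ G := gaussMass_nonneg A
  obtain ⟨s, hs, hdomΩ, hmass⟩ := hdom n hn c₂ A H hA hH
  have htail : ∀ {s : ℝ}, 1 / 2 ≤ s → ∀ {ρ : ℝ}, r₁ * N / 2 ≤ ρ →
      ∫ θ in (cube n ρ)ᶜ, Real.exp (-(s * quad A θ)) ≤
        2 * (n * Real.exp (-(2 * c₃ * N ^ 2))) * ∫ θ, Real.exp (-(s * quad A θ)) := by
    intro s hs ρ hρ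
    have hρ0 : 0 ≤ ρ := le_trans (by positivity) hρ
    refine (setIntegral_compl_cube_le hb hA.posDef hA.inv_le hA.inv_diag_le hs hρ0).trans ?_
    refine mul_le_mul_of_nonneg_right ?_ (integral_nonneg fun θ => (Real.exp_pos _).le)
    rw [mul_assoc]
    have : 2 * c₃ * N ^ 2 ≤ ρ ^ 2 / (2 * b) := by
      rw [le_div_iff₀ (by positivity)]
      have h1 : 2 * c₃ * N ^ 2 * (2 * b) = (r₁ * N / 2) ^ 2 := by
        rw [hc₃]
        field_simp
        ring
      rw [h1]
      gcongr
    gcongr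
  have hsplit : Real.exp (-(2 * c₃ * N ^ 2)) =
      Real.exp (-(c₃ * N ^ 2)) * Real.exp (-(c₃ * N ^ 2)) := by
    rw [← Real.exp_add]
    congr 1
    ring
  have hexp1 : Real.exp (-(c₃ * N ^ 2)) ≤ 1 := by
    rw [Real.exp_le_one_iff]
    have : 0 ≤ c₃ * N ^ 2 := by positivity
    linarith
  have hs0 : 0 < s := by linarith
  have hsi := integrable_exp_neg_quad hb hA.posDef hA.inv_le hs0
  have hRN : 0 ≤ r₂ * N := by positivity
  have hwi : IntegrableOn (fun θ => Real.exp (action A H θ)) Ω := by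
    simpa using integrable_exp_action hH hRN hΩ₂ (continuous_const (y := (1 : ℝ)))
  have hall : ∫ θ in Ω, Real.exp (action A H θ) ≤ M ^ 2 * G := by
    calc ∫ θ in Ω, Real.exp (action A H θ)
        ≤ ∫ θ in Ω, M * Real.exp (-(s * quad A θ)) := by
          refine integral_mono_ae hwi (hsi.const_mul M).integrableOn ?_
          filter_upwards [ae_restrict_mem₀ hΩm] with θ hθ using hdomΩ θ (hΩ₂ hθ)
      _ ≤ ∫ θ, M * Real.exp (-(s * quad A θ)) :=
          setIntegral_le_integral (hsi.const_mul M)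
            (Filter.Eventually.of_forall fun θ => by positivity)
      _ = M * ∫ θ, Real.exp (-(s * quad A θ)) := integral_const_mul _ _
      _ ≤ M * (M * G) := by gcongr
      _ = M ^ 2 * G := by ring
  have houter : ∫ θ in Ω ∩ (cube n (r₁ * N / 2))ᶜ, Real.exp (action A H θ) ≤ T₀ / n * G := by
    have hcm := (measurableSet_cube n (r₁ * N / 2)).compl
    calc ∫ θ in Ω ∩ (cube n (r₁ * N / 2))ᶜ, Real.exp (action A H θ)
        ≤ ∫ θ in Ω ∩ (cube n (r₁ * N / 2))ᶜ, M * Real.exp (-(s * quad A θ)) := by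
          refine integral_mono_ae (hwi.mono_set Set.inter_subset_left)
            (hsi.const_mul M).integrableOn ?_
          filter_upwards [ae_restrict_mem₀ (hΩm.inter hcm.nullMeasurableSet)] with θ hθ
            using hdomΩ θ (hΩ₂ hθ.1)
      _ ≤ ∫ θ in (cube n (r₁ * N / 2))ᶜ, M * Real.exp (-(s * quad A θ)) :=
          setIntegral_mono_set (hsi.const_mul M).integrableOn
            (Filter.Eventually.of_forall fun θ => by positivity)
            (Filter.Eventually.of_forall fun θ hθ => hθ.2)
      _ = M * ∫ θ in (cube n (r₁ * N / 2))ᶜ, Real.exp (-(s * quad A θ)) := integral_const_mul _ _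
      _ ≤ M * (2 * (n * Real.exp (-(2 * c₃ * N ^ 2))) * (M * G)) := by
          refine mul_le_mul_of_nonneg_left ((htail hs le_rfl).trans ?_) hM0.le
          gcongr
      _ ≤ M * (2 * (C₁ / n) * (M * G)) := by
          have : n * Real.exp (-(2 * c₃ * N ^ 2)) ≤ C₁ / n := by
            rw [le_div_iff₀ hn']
            calc _ = n ^ 2 * Real.exp (-(c₃ * N ^ 2)) * Real.exp (-(c₃ * N ^ 2)) := by
                  rw [hsplit]
                  ring
              _ ≤ C₁ * 1 := by gcongr
              _ = C₁ := mul_one _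
          gcongr
      _ = T₀ / n * G := by
          rw [hT₀]
          ring
  refine ⟨?_, ?_, ?_⟩
  · have hi : Integrable (fun θ => Real.exp (-(1 * quad A θ))) :=
      integrable_exp_neg_quad hb hA.posDef hA.inv_le one_pos
    have e1 : bracket (action A 0) Ω (fun _ => (1 : ℝ)) =
        ∫ θ in Ω, Real.exp (-(1 * quad A θ)) := by
      simp [bracket, action]
    have e2 : G = ∫ θ, Real.exp (-(1 * quad A θ)) := by
      rw [hG, gaussMass_eq]
      simp
    have e3 := integral_add_compl₀ hΩm hi
    have e4 : 0 ≤ ∫ θ in Ωᶜ, Real.exp (-(1 * quad A θ)) :=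
      integral_nonneg fun θ => (Real.exp_pos _).le
    have e5 : ∫ θ in Ωᶜ, Real.exp (-(1 * quad A θ)) ≤
        ∫ θ in (cube n (r₁ * N))ᶜ, Real.exp (-(1 * quad A θ)) :=
      setIntegral_mono_set hi.integrableOn
        (Filter.Eventually.of_forall fun θ => (Real.exp_pos _).le)
        (Filter.Eventually.of_forall fun θ hθ h => hθ (hΩ₁ h))
    have hrN : 0 < r₁ * N := by positivity
    have e6 := htail (s := 1) (by norm_num) (ρ := r₁ * N) (by linarith)
    rw [← e2] at e3 e6
    have e7 : 2 * (n * Real.exp (-(2 * c₃ * N ^ 2))) ≤ C * Real.exp (-c₃ * N ^ 2) := by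
      have f1 : n * Real.exp (-(c₃ * N ^ 2)) ≤ C₁ := by
        refine le_trans ?_ hexpn
        have : (n : ℝ) ≤ n ^ 2 := by nlinarith
        gcongr
      have f2 : 2 * C₁ ≤ C := by
        rw [hC]
        have : 0 ≤ M ^ 2 + (L₀ * M ^ 2 + (1 + 2 * r₂ + K / r₁ * S) * T₀) := by positivity
        linarith
      rw [hsplit, neg_mul]
      calc _ = 2 * (n * Real.exp (-(c₃ * N ^ 2))) * Real.exp (-(c₃ * N ^ 2)) := by ring
        _ ≤ C * Real.exp (-(c₃ * N ^ 2)) := by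
            refine mul_le_mul_of_nonneg_right ?_ (Real.exp_pos _).le
            linarith
    rw [e1, abs_sub_comm, abs_of_nonneg (by linarith)]
    have e8 := mul_le_mul_of_nonneg_right e7 hG0
    linarith
  · refine hall.trans (mul_le_mul_of_nonneg_right ?_ hG0)
    rw [hC]
    have : 0 ≤ 2 * C₁ + (L₀ * M ^ 2 + (1 + 2 * r₂ + K / r₁ * S) * T₀) := by positivity
    linarith
  · intro k E _ _ g g' G₀ G₁ hg hg' hgd hG₀ hG₁
    have h0Ω : (0 : Fin n → ℝ) ∈ Ω := hΩ₁ fun j => by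
      simp only [Pi.zero_apply, abs_zero]
      positivity
    have hG₀0 : 0 ≤ G₀ := (norm_nonneg _).trans (hG₀ 0 h0Ω)
    have hG₁0 : 0 ≤ G₁ := (norm_nonneg _).trans (hG₁ 0 h0Ω)
    have hN3 : N ≤ N ^ 3 := le_self_pow₀ hN1 (by norm_num)
    have hSk := hA.sum_abs_inv_le ha hb k
    have hL : ∀ θ ∈ cube n (r₁ * N),
        |fderiv ℝ H θ (A⁻¹ *ᵥ Pi.single k 1)| ≤ L₀ * N ^ 3 / n := by
      intro θ hθ
      have hθ' := (mem_cube_iff_norm_le (by positivity) θ).1 hθ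
      refine (abs_fderiv_le hc₂ hH hθ' _).trans ?_
      have : ∑ j, |(A⁻¹ *ᵥ Pi.single k 1) j| ≤ S := by simpa using hSk
      calc _ ≤ S * (c₂ * (r₁ ^ 3 * N ^ 3 + r₁ * N ^ 3) / n) := by
            rw [mul_pow]
            gcongr
        _ = _ := by
            rw [hL₀]
            ring
    have h := hstein n c₁ c₂ A H Ω (r₁ * N) (r₂ * N) (L₀ * N ^ 3 / n) k hA.posDef hH hΩm
      (by positivity) hRN (by positivity) hΩ₁ hΩ₂ hL E g g' G₀ G₁ hg hg' hgd hG₀ hG₁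
    refine h.trans ?_
    have hcoef : G₁ + 2 * (r₂ * N) * G₀ + K / (r₁ * N) * (∑ j, |A⁻¹ j k|) * G₀ ≤
        (1 + 2 * r₂ + K / r₁ * S) * (G₀ * N ^ 3 + G₁) := by
      have i1 : K / (r₁ * N) ≤ K / r₁ :=
        div_le_div_of_nonneg_left hK.le hr₁ (le_mul_of_one_le_right hr₁.le hN1)
      have i2 : K / (r₁ * N) * (∑ j, |A⁻¹ j k|) * G₀ ≤ K / r₁ * S * (G₀ * N ^ 3 + G₁) := by
        have : G₀ ≤ G₀ * N ^ 3 + G₁ := by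
          have := le_mul_of_one_le_right hG₀0 (hN1.trans hN3)
          linarith
        gcongr
      have i3 : 2 * (r₂ * N) * G₀ ≤ 2 * r₂ * (G₀ * N ^ 3 + G₁) := by
        have : N * G₀ ≤ G₀ * N ^ 3 + G₁ := by
          have := mul_le_mul_of_nonneg_left hN3 hG₀0
          linarith
        calc 2 * (r₂ * N) * G₀ = 2 * r₂ * (N * G₀) := by ring
          _ ≤ _ := by gcongr
      have i4 : 0 ≤ G₀ * N ^ 3 := by positivity
      linarith
    have hwn : 0 ≤ ∫ θ in Ω ∩ (cube n (r₁ * N / 2))ᶜ, Real.exp (action A H θ) :=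
      integral_nonneg fun θ => (Real.exp_pos _).le
    calc _ ≤ G₀ * (L₀ * N ^ 3 / n) * (M ^ 2 * G) +
          (1 + 2 * r₂ + K / r₁ * S) * (G₀ * N ^ 3 + G₁) * (T₀ / n * G) := by gcongr
      _ = (L₀ * M ^ 2 * (G₀ * N ^ 3) + (1 + 2 * r₂ + K / r₁ * S) * T₀ * (G₀ * N ^ 3 + G₁))
            / n * G := by ring
      _ ≤ C * (G₀ * N ^ 3 + G₁) / n * G := by
          have h1 : L₀ * M ^ 2 * (G₀ * N ^ 3) ≤ L₀ * M ^ 2 * (G₀ * N ^ 3 + G₁) := by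
            gcongr
            linarith
          have h2 : 0 ≤ (2 * C₁ + M ^ 2) * (G₀ * N ^ 3 + G₁) := by positivity
          gcongr
          rw [hC]
          linarith
      _ = _ := by ring

/-! ### Algebra of brackets -/

section Bracket

variable {c₁ c₂ R : ℝ} {A : Matrix (Fin n) (Fin n) ℝ} {H : (Fin n → ℝ) → ℝ}
  {Ω : Set (Fin n → ℝ)}

lemma bracket_sub (hH : IsPerturbation c₁ c₂ A H) (hR : 0 ≤ R) (hΩ : Ω ⊆ cube n R)
    {E : Type} [NormedAddCommGroup E] [NormedSpace ℝ E] {g h : (Fin n → ℝ) → E}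
    (hg : Continuous g) (hh : Continuous h) :
    bracket (action A H) Ω (fun θ => g θ - h θ) =
      bracket (action A H) Ω g - bracket (action A H) Ω h := by
  unfold bracket
  rw [← integral_sub (integrable_exp_action hH hR hΩ hg) (integrable_exp_action hH hR hΩ hh)]
  simp only [smul_sub]

lemma bracket_add (hH : IsPerturbation c₁ c₂ A H) (hR : 0 ≤ R) (hΩ : Ω ⊆ cube n R)
    {E : Type} [NormedAddCommGroup E] [NormedSpace ℝ E] {g h : (Fin n → ℝ) → E}
    (hg : Continuous g) (hh : Continuous h) :
    bracket (action A H) Ω (fun θ => g θ + h θ) =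
      bracket (action A H) Ω g + bracket (action A H) Ω h := by
  unfold bracket
  rw [← integral_add (integrable_exp_action hH hR hΩ hg) (integrable_exp_action hH hR hΩ hh)]
  simp only [smul_add]

lemma bracket_const_mul {𝕜 : Type} [RCLike 𝕜] (F : (Fin n → ℝ) → ℝ) (c : 𝕜)
    (g : (Fin n → ℝ) → 𝕜) : bracket F Ω (fun θ => c * g θ) = c * bracket F Ω g := by
  unfold bracket
  rw [← integral_const_mul]
  simp only [mul_smul_comm]

lemma bracket_one (F : (Fin n → ℝ) → ℝ) :
    bracket F Ω (fun _ => (1 : ℝ)) = ∫ θ in Ω, Real.exp (F θ) := by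
  simp [bracket]

lemma bracket_one_nonneg (F : (Fin n → ℝ) → ℝ) : 0 ≤ bracket F Ω (fun _ => (1 : ℝ)) := by
  rw [bracket_one]
  exact integral_nonneg fun θ => (Real.exp_pos _).le

lemma norm_bracket_le (hH : IsPerturbation c₁ c₂ A H) (hΩm : NullMeasurableSet Ω volume)
    (hR : 0 ≤ R) (hΩ : Ω ⊆ cube n R)
    {E : Type} [NormedAddCommGroup E] [NormedSpace ℝ E] {g : (Fin n → ℝ) → E} {B : ℝ}
    (hB : ∀ θ ∈ Ω, ‖g θ‖ ≤ B) :
    ‖bracket (action A H) Ω g‖ ≤ B * bracket (action A H) Ω (fun _ => (1 : ℝ)) := by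
  have hi : IntegrableOn (fun θ => Real.exp (action A H θ)) Ω := by
    simpa using integrable_exp_action hH hR hΩ (continuous_const (y := (1 : ℝ)))
  rw [bracket_one, ← integral_const_mul]
  refine norm_integral_le_of_norm_le (hi.const_mul B) ?_
  filter_upwards [ae_restrict_mem₀ hΩm] with θ hθ
  rw [norm_smul, Real.norm_eq_abs, Real.abs_exp, mul_comm]
  exact mul_le_mul_of_nonneg_right (hB θ hθ) (Real.exp_pos _).le

/-- The form used for moments: since `⟨θ_k g⟩ ≈ ½⟨g'⟩`, an approximation `⟨g'⟩ ≈ 2m⟨1⟩_F` yields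
`⟨θ_k g⟩ ≈ m⟨1⟩_F`. -/
lemma SteinBound.abs_sub_le {C N : ℝ} (hS : SteinBound C N A H Ω)
    (hH : IsPerturbation c₁ c₂ A H) (hR : 0 ≤ R) (hΩ : Ω ⊆ cube n R) (k : Fin n)
    {f g g' : (Fin n → ℝ) → ℝ} {G₀ G₁ m e : ℝ} (hg : Continuous g) (hg' : Continuous g')
    (hd : ∀ θ, HasLineDerivAt ℝ g (g' θ) θ (A⁻¹ *ᵥ Pi.single k 1))
    (hG₀ : ∀ θ ∈ Ω, |g θ| ≤ G₀) (hG₁ : ∀ θ ∈ Ω, |g' θ| ≤ G₁) (hf : ∀ θ, f θ = θ k * g θ)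
    (he : |bracket (action A H) Ω g' - 2 * m * bracket (action A H) Ω (fun _ => (1 : ℝ))| ≤ e) :
    |bracket (action A H) Ω f - m * bracket (action A H) Ω (fun _ => (1 : ℝ))| ≤
      C * ((G₀ * N ^ 3 + G₁) / n) * gaussMass A + e := by
  have h := hS k ℝ g g' G₀ G₁ hg hg' hd hG₀ hG₁
  have hfun : (fun θ : Fin n → ℝ => g' θ - (2 * θ k) • g θ) = fun θ => g' θ - 2 * f θ := by
    ext θ
    rw [hf, smul_eq_mul, mul_assoc]
  have hfc : Continuous f := by
    have : f = fun θ => θ k * g θ := funext hf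
    rw [this]
    fun_prop
  rw [hfun, bracket_sub hH hR hΩ hg' (by fun_prop), bracket_const_mul, Real.norm_eq_abs] at h
  rw [abs_le] at *
  constructor <;> linarith [h.1, h.2, he.1, he.2]

end Bracket

/-! ### The oscillating observable -/

section Oscillation

lemma osc_add_smul (p θ v : Fin n → ℝ) (k : Fin n) (t : ℝ) :
    osc p k (θ + t • v) =
      osc p k θ * Complex.exp (t * (Complex.I * (∑ j ∈ Finset.univ.erase k, p j * v j : ℝ))) := by
  have h : v ⬝ᵥ p = p k * v k + ∑ j ∈ Finset.univ.erase k, p j * v j := by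
    rw [Finset.add_sum_erase Finset.univ (fun j => p j * v j) (Finset.mem_univ k),
      dotProduct_comm]
    rfl
  unfold osc
  rw [← Complex.exp_add, add_dotProduct, smul_dotProduct, h]
  congr 1
  simp only [Pi.add_apply, Pi.smul_apply, smul_eq_mul]
  push_cast
  ring

lemma hasLineDerivAt_osc (p θ v : Fin n → ℝ) (k : Fin n) :
    HasLineDerivAt ℝ (osc p k)
      (Complex.I * (∑ j ∈ Finset.univ.erase k, p j * v j : ℝ) * osc p k θ) θ v := by
  unfold HasLineDerivAt
  simp only [osc_add_smul]
  set z : ℂ := Complex.I * (∑ j ∈ Finset.univ.erase k, p j * v j : ℝ) with hz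
  have h1 : HasDerivAt (fun t : ℝ => (t : ℂ) * z) z 0 := by
    simpa using (Complex.ofRealCLM.hasDerivAt (x := (0 : ℝ))).mul_const z
  refine (h1.cexp.const_mul (osc p k θ)).congr_deriv ?_
  simp
  ring

lemma norm_osc (p θ : Fin n → ℝ) (k : Fin n) : ‖osc p k θ‖ = 1 := by
  have : osc p k θ = Complex.exp (((θ ⬝ᵥ p - p k * θ k : ℝ) : ℂ) * Complex.I) := by
    unfold osc
    congr 1
    push_cast
    ring
  rw [this, Complex.norm_exp_ofReal_mul_I]

lemma continuous_osc (p : Fin n → ℝ) (k : Fin n) : Continuous (osc p k) := by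
  unfold osc
  fun_prop

/-- From `0 ≤ 1 - e^{-x} ≤ x` for `x ≥ 0`. With `p_k² = O(1/n)`, inserting the extra Gaussian weight
costs only `O(N²/n)`. -/
lemma norm_bracket_osc_sub_le {c₁ c₂ R : ℝ} {A : Matrix (Fin n) (Fin n) ℝ}
    {H : (Fin n → ℝ) → ℝ} {Ω : Set (Fin n → ℝ)} (hH : IsPerturbation c₁ c₂ A H)
    (hΩm : NullMeasurableSet Ω volume) (hR : 0 ≤ R) (hΩ : Ω ⊆ cube n R) (p : Fin n → ℝ)
    (k : Fin n) :
    ‖bracket (action A H) Ω (osc p k) -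
        bracket (fun θ => action A H θ - 1 / 2 * p k ^ 2 * θ k ^ 2) Ω (osc p k)‖ ≤
      p k ^ 2 * R ^ 2 * bracket (action A H) Ω (fun _ => (1 : ℝ)) := by
  have hosc := continuous_osc p k
  have h1 : bracket (fun θ => action A H θ - 1 / 2 * p k ^ 2 * θ k ^ 2) Ω (osc p k) =
      bracket (action A H) Ω
        (fun θ => Real.exp (-(1 / 2 * p k ^ 2 * θ k ^ 2)) • osc p k θ) := by
    unfold bracket
    simp only [smul_smul, ← Real.exp_add, sub_eq_add_neg]
  rw [h1, ← bracket_sub hH hR hΩ hosc (by fun_prop)]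
  refine norm_bracket_le hH hΩm hR hΩ fun θ hθ => ?_
  have h2 : osc p k θ - Real.exp (-(1 / 2 * p k ^ 2 * θ k ^ 2)) • osc p k θ =
      (1 - Real.exp (-(1 / 2 * p k ^ 2 * θ k ^ 2))) • osc p k θ := by
    rw [sub_smul, one_smul]
  have h3 := Real.add_one_le_exp (-(1 / 2 * p k ^ 2 * θ k ^ 2))
  have h4 : Real.exp (-(1 / 2 * p k ^ 2 * θ k ^ 2)) ≤ 1 := by
    rw [Real.exp_le_one_iff]
    have : 0 ≤ 1 / 2 * p k ^ 2 * θ k ^ 2 := by positivity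
    linarith
  have h5 : θ k ^ 2 ≤ R ^ 2 := by
    rw [← sq_abs]
    have := hΩ hθ k
    gcongr
  rw [h2, norm_smul, norm_osc, mul_one, Real.norm_eq_abs, abs_of_nonneg (by linarith)]
  have h6 : p k ^ 2 * θ k ^ 2 ≤ p k ^ 2 * R ^ 2 := by gcongr
  have h7 : 0 ≤ p k ^ 2 * θ k ^ 2 := by positivity
  linarith

lemma IsAdmissible.abs_sum_mul_inv_le {a b c : ℝ} (ha : 0 < a) (hb : 0 < b) (hc : 0 ≤ c)
    {A : Matrix (Fin n) (Fin n) ℝ} (hA : IsAdmissible a b A) {p : Fin n → ℝ} (hp : ‖p‖ ≤ c)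
    (k : Fin n) : |∑ j ∈ Finset.univ.erase k, p j * A⁻¹ j k| ≤ c * (a + a ^ 2 * b) := by
  have hn : (0 : ℝ) < n := by exact_mod_cast k.pos
  calc _ ≤ ∑ j ∈ Finset.univ.erase k, |p j * A⁻¹ j k| := Finset.abs_sum_le_sum_abs _ _
    _ ≤ ∑ j ∈ Finset.univ.erase k, c * ((a + a ^ 2 * b) / n) := by
        refine Finset.sum_le_sum fun j hj => ?_
        rw [abs_mul]
        have h1 : |p j| ≤ c := (norm_le_pi_norm p j).trans hp
        have h2 := hA.abs_inv_le ha hb (Finset.ne_of_mem_erase hj)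
        gcongr
    _ ≤ ∑ _j : Fin n, c * ((a + a ^ 2 * b) / n) :=
        Finset.sum_le_sum_of_subset_of_nonneg (Finset.erase_subset _ _)
          fun _ _ _ => by positivity
    _ = c * (a + a ^ 2 * b) := by
        simp
        field_simp

/-- The factor is an eigenfunction of `∂_v` with eigenvalue `iσ`, where `σ` omits `j = k` because
`p_kθ_k` was removed from the phase. Stein's identity gives `(i/2)σ` times the bracket for `F`; the
weight is then changed, using `σ = O(1)`. -/
lemma SteinBound.norm_bracket_osc_le {a b c c₁ c₂ R C N : ℝ} (ha : 0 < a) (hb : 0 < b)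
    (hc : 0 ≤ c) {A : Matrix (Fin n) (Fin n) ℝ} {H : (Fin n → ℝ) → ℝ}
    {Ω : Set (Fin n → ℝ)} (hS : SteinBound C N A H Ω) (hA : IsAdmissible a b A)
    (hH : IsPerturbation c₁ c₂ A H) (hΩm : NullMeasurableSet Ω volume) (hR : 0 ≤ R)
    (hΩ : Ω ⊆ cube n R)
    (hI : bracket (action A H) Ω (fun _ => (1 : ℝ)) ≤ C * gaussMass A)
    {p : Fin n → ℝ} (hp : ‖p‖ ≤ c) (k : Fin n) :
    ‖bracket (action A H) Ω (fun θ => (θ k : ℂ) * osc p k θ) -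
        Complex.I / 2 * ((∑ j ∈ Finset.univ.erase k, p j * A⁻¹ j k : ℝ) : ℂ) *
          bracket (fun θ => action A H θ - 1 / 2 * p k ^ 2 * θ k ^ 2) Ω (osc p k)‖ ≤
      C * ((N ^ 3 + c * (a + a ^ 2 * b)) / n) * gaussMass A +
        c * (a + a ^ 2 * b) * (‖p‖ ^ 2 * R ^ 2 * (C * gaussMass A)) := by
  set σ : ℝ := ∑ j ∈ Finset.univ.erase k, p j * A⁻¹ j k with hσ
  have hσle : |σ| ≤ c * (a + a ^ 2 * b) := hA.abs_sum_mul_inv_le ha hb hc hp k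
  have hosc := continuous_osc p k
  have hG := gaussMass_nonneg A
  have hd : ∀ θ, HasLineDerivAt ℝ (osc p k) (Complex.I * (σ : ℂ) * osc p k θ) θ
      (A⁻¹ *ᵥ Pi.single k 1) := fun θ => by
    simpa [hσ] using hasLineDerivAt_osc p θ (A⁻¹ *ᵥ Pi.single k 1) k
  have h := hS k ℂ (osc p k) (fun θ => Complex.I * (σ : ℂ) * osc p k θ) 1
    (c * (a + a ^ 2 * b)) hosc (by fun_prop) hd (fun θ _ => (norm_osc p θ k).le)
    (fun θ _ => by
      rw [norm_mul, norm_mul, norm_osc, Complex.norm_I, one_mul, mul_one, Complex.norm_real]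
      exact hσle)
  have hfun : (fun θ : Fin n → ℝ => Complex.I * (σ : ℂ) * osc p k θ - (2 * θ k) • osc p k θ) =
      fun θ => Complex.I * (σ : ℂ) * osc p k θ - 2 * ((θ k : ℂ) * osc p k θ) := by
    ext θ
    rw [Complex.real_smul]
    push_cast
    ring
  rw [hfun, bracket_sub hH hR hΩ (by fun_prop) (by fun_prop), bracket_const_mul,
    bracket_const_mul, one_mul] at h
  have h2 := norm_bracket_osc_sub_le hH hΩm hR hΩ p k
  set X := bracket (action A H) Ω (fun θ => (θ k : ℂ) * osc p k θ)
  set Y := bracket (action A H) Ω (osc p k)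
  set Z := bracket (fun θ => action A H θ - 1 / 2 * p k ^ 2 * θ k ^ 2) Ω (osc p k)
  have e : X - Complex.I / 2 * (σ : ℂ) * Z =
      -(1 / 2) * (Complex.I * (σ : ℂ) * Y - 2 * X) + Complex.I / 2 * (σ : ℂ) * (Y - Z) := by
    ring
  rw [e]
  refine (norm_add_le _ _).trans (add_le_add ?_ ?_)
  · rw [norm_mul]
    have : ‖(-(1 / 2) : ℂ)‖ ≤ 1 := by norm_num
    exact (mul_le_of_le_one_left (norm_nonneg _) this).trans h
  · rw [norm_mul, norm_mul, Complex.norm_real, Real.norm_eq_abs]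
    have i1 : ‖(Complex.I / 2 : ℂ)‖ ≤ 1 := by norm_num
    have i2 : p k ^ 2 ≤ ‖p‖ ^ 2 := by
      rw [← sq_abs]
      have : |p k| ≤ ‖p‖ := norm_le_pi_norm p k
      gcongr
    have i3 := bracket_one_nonneg (Ω := Ω) (action A H)
    calc _ ≤ 1 * (c * (a + a ^ 2 * b)) *
          (p k ^ 2 * R ^ 2 * bracket (action A H) Ω (fun _ => (1 : ℝ))) := by gcongr
      _ ≤ 1 * (c * (a + a ^ 2 * b)) * (‖p‖ ^ 2 * R ^ 2 * (C * gaussMass A)) := by gcongr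
      _ = _ := by ring

end Oscillation

/-! ### Second and fourth moments -/

lemma hasDerivAt_coord (A : Matrix (Fin n) (Fin n) ℝ) (θ : Fin n → ℝ) (j k : Fin n) :
    HasDerivAt (fun t : ℝ => (θ + t • (A⁻¹ *ᵥ Pi.single k 1)) j) (A⁻¹ j k) 0 := by
  have h := ((hasDerivAt_id (0 : ℝ)).mul_const (A⁻¹ j k)).const_add (θ j)
  simpa using! h

section Moments

variable {a b c₁ c₂ r C N : ℝ} {A : Matrix (Fin n) (Fin n) ℝ} {H : (Fin n → ℝ) → ℝ}
  {Ω : Set (Fin n → ℝ)}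

lemma IsAdmissible.abs_inv_le_one_add (ha : 0 < a) (hb : 0 < b) (hA : IsAdmissible a b A)
    (j k : Fin n) : |A⁻¹ j k| ≤ 1 + (a + a ^ 2 * b) :=
  (Finset.single_le_sum (f := fun j => |A⁻¹ j k|) (fun _ _ => abs_nonneg _)
    (Finset.mem_univ j)).trans (hA.sum_abs_inv_le ha hb k)

/-- Stein with `g = θ_k`, whose derivative is the constant `(A⁻¹)_kk = 1 + O(1/n)`. The power `N⁴`
is `|g| ≤ rN` times `N³`. -/
lemma SteinBound.abs_bracket_sq_sub_le (ha : 0 < a) (hb : 0 < b) (hC : 0 ≤ C) (hN : 1 ≤ N)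
    (hr : 0 ≤ r) (hS : SteinBound C N A H Ω) (hA : IsAdmissible a b A)
    (hH : IsPerturbation c₁ c₂ A H) (hΩ : Ω ⊆ cube n (r * N))
    (hI : bracket (action A H) Ω (fun _ => (1 : ℝ)) ≤ C * gaussMass A) (k : Fin n) :
    |bracket (action A H) Ω (fun θ => θ k ^ 2) -
        1 / 2 * bracket (action A H) Ω (fun _ => (1 : ℝ))| ≤
      C * (r + 1 + 2 * (a + a ^ 2 * b)) * (N ^ 4 / n) * gaussMass A := by
  have hG := gaussMass_nonneg A
  have hI0 := bracket_one_nonneg (Ω := Ω) (action A H)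
  have hN0 : 0 < N := by linarith
  have hN4 : 1 ≤ N ^ 4 := one_le_pow₀ hN
  have he : |bracket (action A H) Ω (fun _ => A⁻¹ k k) -
      2 * (1 / 2) * bracket (action A H) Ω (fun _ => (1 : ℝ))| ≤
      (a + a ^ 2 * b) / n * (C * gaussMass A) := by
    have h1 := bracket_const_mul (Ω := Ω) (action A H) (A⁻¹ k k) (fun _ => (1 : ℝ))
    simp only [mul_one] at h1
    rw [h1, mul_one_div_cancel (two_ne_zero), ← sub_mul, abs_mul, abs_of_nonneg hI0]
    have := hA.abs_inv_diag_sub_one_le ha hb k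
    gcongr
  refine (hS.abs_sub_le hH (by positivity) hΩ k (g := fun θ => θ k) (g' := fun _ => A⁻¹ k k)
    (by fun_prop) (by fun_prop) (fun θ => hasDerivAt_coord A θ k k) (fun θ hθ => hΩ hθ k)
    (fun θ _ => hA.abs_inv_le_one_add ha hb k k) (fun θ => sq (θ k)) he).trans ?_
  have : r * N * N ^ 3 + (1 + (a + a ^ 2 * b)) + (a + a ^ 2 * b) ≤
      (r + 1 + 2 * (a + a ^ 2 * b)) * N ^ 4 := by
    have : 0 ≤ (1 + 2 * (a + a ^ 2 * b)) * (N ^ 4 - 1) :=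
      mul_nonneg (by positivity) (by linarith)
    linarith
  calc _ = C * ((r * N * N ^ 3 + (1 + (a + a ^ 2 * b)) + (a + a ^ 2 * b)) / n) *
        gaussMass A := by ring
    _ ≤ C * ((r + 1 + 2 * (a + a ^ 2 * b)) * N ^ 4 / n) * gaussMass A := by gcongr
    _ = _ := by ring

lemma SteinBound.abs_bracket_mul_le (ha : 0 < a) (hb : 0 < b) (hC : 0 ≤ C) (hN : 1 ≤ N)
    (hr : 0 ≤ r) (hS : SteinBound C N A H Ω) (hA : IsAdmissible a b A)
    (hH : IsPerturbation c₁ c₂ A H) (hΩ : Ω ⊆ cube n (r * N))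
    (hI : bracket (action A H) Ω (fun _ => (1 : ℝ)) ≤ C * gaussMass A) {k l : Fin n}
    (hkl : k ≠ l) :
    |bracket (action A H) Ω (fun θ => θ k * θ l)| ≤
      C * (r + 1 + 2 * (a + a ^ 2 * b)) * (N ^ 4 / n) * gaussMass A := by
  have hG := gaussMass_nonneg A
  have hI0 := bracket_one_nonneg (Ω := Ω) (action A H)
  have hN0 : 0 < N := by linarith
  have hN4 : 1 ≤ N ^ 4 := one_le_pow₀ hN
  have he : |bracket (action A H) Ω (fun _ => A⁻¹ l k) -
      2 * 0 * bracket (action A H) Ω (fun _ => (1 : ℝ))| ≤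
      (a + a ^ 2 * b) / n * (C * gaussMass A) := by
    have h1 := bracket_const_mul (Ω := Ω) (action A H) (A⁻¹ l k) (fun _ => (1 : ℝ))
    simp only [mul_one] at h1
    rw [h1, mul_zero, zero_mul, sub_zero, abs_mul, abs_of_nonneg hI0]
    have := hA.abs_inv_le ha hb hkl.symm
    gcongr
  have h := hS.abs_sub_le hH (by positivity) hΩ k (g := fun θ => θ l) (g' := fun _ => A⁻¹ l k)
    (by fun_prop) (by fun_prop) (fun θ => hasDerivAt_coord A θ l k) (fun θ hθ => hΩ hθ l)
    (fun θ _ => hA.abs_inv_le_one_add ha hb l k) (fun θ => rfl) he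
  rw [zero_mul, sub_zero] at h
  refine h.trans ?_
  have : r * N * N ^ 3 + (1 + (a + a ^ 2 * b)) + (a + a ^ 2 * b) ≤
      (r + 1 + 2 * (a + a ^ 2 * b)) * N ^ 4 := by
    have : 0 ≤ (1 + 2 * (a + a ^ 2 * b)) * (N ^ 4 - 1) :=
      mul_nonneg (by positivity) (by linarith)
    linarith
  calc _ = C * ((r * N * N ^ 3 + (1 + (a + a ^ 2 * b)) + (a + a ^ 2 * b)) / n) *
        gaussMass A := by ring
    _ ≤ C * ((r + 1 + 2 * (a + a ^ 2 * b)) * N ^ 4 / n) * gaussMass A := by gcongr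
    _ = _ := by ring

/-- The common constant in the bounds for the fourth moments. -/
def quarticConst (a b r C : ℝ) : ℝ :=
  C * (r ^ 3 + 3 * r ^ 2 * (1 + (a + a ^ 2 * b)) + 3 * r ^ 2 * (a + a ^ 2 * b) +
    3 * (r + 1 + 2 * (a + a ^ 2 * b)))

/-- Shared bookkeeping for `g` cubic: `x` is the error in evaluating `⟨g'⟩`, made of `O(1/n)`
entries of `A⁻¹ - I` times quadratic moments, plus second-moment errors. Only `N⁶` actually occurs;
`N⁷` is slack. -/
lemma quarticConst_bound (ha : 0 < a) (hb : 0 < b) (hC : 0 ≤ C) (hN : 1 ≤ N) (hr : 0 ≤ r)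
    {G x : ℝ} (hG : 0 ≤ G) (hx : x ≤ 3 * ((r * N) ^ 2 * ((a + a ^ 2 * b) / n * (C * G))) +
      3 * (C * (r + 1 + 2 * (a + a ^ 2 * b)) * (N ^ 4 / n) * G)) :
    C * (((r * N) ^ 3 * N ^ 3 + 3 * (r * N) ^ 2 * (1 + (a + a ^ 2 * b))) / n) * G + x ≤
      quarticConst a b r C * (N ^ 7 / n) * G := by
  have hN0 : 0 < N := by linarith
  have h2 : N ^ 2 ≤ N ^ 7 := pow_le_pow_right₀ hN (by norm_num)
  have h4 : N ^ 4 ≤ N ^ 7 := pow_le_pow_right₀ hN (by norm_num)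
  have h6 : N ^ 6 ≤ N ^ 7 := pow_le_pow_right₀ hN (by norm_num)
  calc _ ≤ C * (((r * N) ^ 3 * N ^ 3 + 3 * (r * N) ^ 2 * (1 + (a + a ^ 2 * b))) / n) * G +
        (3 * ((r * N) ^ 2 * ((a + a ^ 2 * b) / n * (C * G))) +
        3 * (C * (r + 1 + 2 * (a + a ^ 2 * b)) * (N ^ 4 / n) * G)) := by gcongr
    _ = C * ((r ^ 3 * N ^ 6 + 3 * r ^ 2 * (1 + (a + a ^ 2 * b)) * N ^ 2 +
        3 * r ^ 2 * (a + a ^ 2 * b) * N ^ 2 + 3 * (r + 1 + 2 * (a + a ^ 2 * b)) * N ^ 4) / n) *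
          G := by ring
    _ ≤ C * ((r ^ 3 * N ^ 7 + 3 * r ^ 2 * (1 + (a + a ^ 2 * b)) * N ^ 7 +
        3 * r ^ 2 * (a + a ^ 2 * b) * N ^ 7 + 3 * (r + 1 + 2 * (a + a ^ 2 * b)) * N ^ 7) / n) *
          G := by gcongr
    _ = _ := by
        rw [quarticConst]
        ring

lemma abs_bracket_sq_le (hRN : 0 ≤ r * N) (hH : IsPerturbation c₁ c₂ A H)
    (hΩm : NullMeasurableSet Ω volume) (hΩ : Ω ⊆ cube n (r * N))
    (hI : bracket (action A H) Ω (fun _ => (1 : ℝ)) ≤ C * gaussMass A) (k : Fin n) :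
    |bracket (action A H) Ω (fun θ => θ k ^ 2)| ≤ (r * N) ^ 2 * (C * gaussMass A) := by
  refine (norm_bracket_le hH hΩm hRN hΩ (g := fun θ => θ k ^ 2) (B := (r * N) ^ 2) fun θ hθ => ?_).trans (by gcongr)
  rw [norm_pow, Real.norm_eq_abs]
  have := hΩ hθ k
  gcongr

/-- Stein with `g = θ_k³` reduces to the second moment: `½ · 3 · ½ = 3/4`. -/
lemma SteinBound.abs_bracket_pow_four_sub_le (ha : 0 < a) (hb : 0 < b) (hC : 0 ≤ C) (hN : 1 ≤ N)
    (hr : 0 ≤ r) (hS : SteinBound C N A H Ω) (hA : IsAdmissible a b A)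
    (hH : IsPerturbation c₁ c₂ A H) (hΩm : NullMeasurableSet Ω volume)
    (hΩ : Ω ⊆ cube n (r * N))
    (hI : bracket (action A H) Ω (fun _ => (1 : ℝ)) ≤ C * gaussMass A) (k : Fin n) :
    |bracket (action A H) Ω (fun θ => θ k ^ 4) -
        3 / 4 * bracket (action A H) Ω (fun _ => (1 : ℝ))| ≤
      quarticConst a b r C * (N ^ 7 / n) * gaussMass A := by
  have hG := gaussMass_nonneg A
  have hRN : 0 ≤ r * N := by positivity
  have hQ := hS.abs_bracket_sq_sub_le ha hb hC hN hr hA hH hΩ hI k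
  have hQ' := abs_bracket_sq_le hRN hH hΩm hΩ hI k
  have hkk := hA.abs_inv_diag_sub_one_le ha hb k
  have hd : ∀ θ, HasLineDerivAt ℝ (fun θ : Fin n → ℝ => θ k ^ 3)
      (3 * A⁻¹ k k * θ k ^ 2) θ (A⁻¹ *ᵥ Pi.single k 1) := fun θ => by
    refine ((hasDerivAt_coord A θ k k).pow 3).congr_deriv ?_
    simp
    ring
  have hG₁ : ∀ θ ∈ Ω, |3 * A⁻¹ k k * θ k ^ 2| ≤ 3 * (r * N) ^ 2 * (1 + (a + a ^ 2 * b)) := by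
    intro θ hθ
    have h1 := hΩ hθ k
    have h2 := hA.abs_inv_le_one_add ha hb k k
    rw [abs_mul, abs_mul, abs_pow, abs_of_pos (by norm_num : (0 : ℝ) < 3)]
    calc _ ≤ 3 * (1 + (a + a ^ 2 * b)) * (r * N) ^ 2 := by gcongr
      _ = _ := by ring
  have hG₀ : ∀ θ ∈ Ω, |θ k ^ 3| ≤ (r * N) ^ 3 := by
    intro θ hθ
    have h1 := hΩ hθ k
    rw [abs_pow]
    gcongr
  refine (hS.abs_sub_le hH hRN hΩ k (g := fun θ => θ k ^ 3)
    (g' := fun θ => 3 * A⁻¹ k k * θ k ^ 2) (by fun_prop) (by fun_prop) hd hG₀ hG₁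
    (fun θ => by ring) le_rfl).trans (quarticConst_bound ha hb hC hN hr hG ?_)
  rw [bracket_const_mul]
  set Q := bracket (action A H) Ω (fun θ => θ k ^ 2)
  set I := bracket (action A H) Ω (fun _ => (1 : ℝ))
  have e : 3 * A⁻¹ k k * Q - 2 * (3 / 4) * I = 3 * ((A⁻¹ k k - 1) * Q) + 3 * (Q - 1 / 2 * I) := by
    ring
  rw [e]
  refine (abs_add_le _ _).trans ?_
  rw [abs_mul, abs_mul, abs_mul, abs_of_pos (by norm_num : (0 : ℝ) < 3)]
  have : |A⁻¹ k k - 1| * |Q| ≤ (a + a ^ 2 * b) / n * ((r * N) ^ 2 * (C * gaussMass A)) := by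
    gcongr
  linarith

/-- With `g = θ_l³` the derivative carries the off-diagonal entry `(A⁻¹)_lk = O(1/n)`, so there is
no main term. -/
lemma SteinBound.abs_bracket_mul_pow_three_le (ha : 0 < a) (hb : 0 < b) (hC : 0 ≤ C)
    (hN : 1 ≤ N) (hr : 0 ≤ r) (hS : SteinBound C N A H Ω) (hA : IsAdmissible a b A)
    (hH : IsPerturbation c₁ c₂ A H) (hΩm : NullMeasurableSet Ω volume)
    (hΩ : Ω ⊆ cube n (r * N))
    (hI : bracket (action A H) Ω (fun _ => (1 : ℝ)) ≤ C * gaussMass A) {k l : Fin n}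
    (hkl : k ≠ l) :
    |bracket (action A H) Ω (fun θ => θ k * θ l ^ 3)| ≤
      quarticConst a b r C * (N ^ 7 / n) * gaussMass A := by
  have hG := gaussMass_nonneg A
  have hRN : 0 ≤ r * N := by positivity
  have hQ' := abs_bracket_sq_le hRN hH hΩm hΩ hI l
  have hlk := hA.abs_inv_le ha hb hkl.symm
  have hd : ∀ θ, HasLineDerivAt ℝ (fun θ : Fin n → ℝ => θ l ^ 3)
      (3 * A⁻¹ l k * θ l ^ 2) θ (A⁻¹ *ᵥ Pi.single k 1) := fun θ => by
    refine ((hasDerivAt_coord A θ l k).pow 3).congr_deriv ?_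
    simp
    ring
  have hG₁ : ∀ θ ∈ Ω, |3 * A⁻¹ l k * θ l ^ 2| ≤ 3 * (r * N) ^ 2 * (1 + (a + a ^ 2 * b)) := by
    intro θ hθ
    have h1 := hΩ hθ l
    have h2 := hA.abs_inv_le_one_add ha hb l k
    rw [abs_mul, abs_mul, abs_pow, abs_of_pos (by norm_num : (0 : ℝ) < 3)]
    calc _ ≤ 3 * (1 + (a + a ^ 2 * b)) * (r * N) ^ 2 := by gcongr
      _ = _ := by ring
  have hG₀ : ∀ θ ∈ Ω, |θ l ^ 3| ≤ (r * N) ^ 3 := by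
    intro θ hθ
    have h1 := hΩ hθ l
    rw [abs_pow]
    gcongr
  have h := hS.abs_sub_le hH hRN hΩ k (m := 0) (g := fun θ => θ l ^ 3)
    (g' := fun θ => 3 * A⁻¹ l k * θ l ^ 2) (by fun_prop) (by fun_prop) hd hG₀ hG₁
    (fun θ => rfl) le_rfl
  rw [zero_mul, sub_zero] at h
  refine h.trans (quarticConst_bound ha hb hC hN hr hG ?_)
  rw [bracket_const_mul, mul_zero, zero_mul, sub_zero, mul_assoc, abs_mul, abs_mul,
    abs_of_pos (by norm_num : (0 : ℝ) < 3)]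
  have h1 : |A⁻¹ l k| * |bracket (action A H) Ω (fun θ => θ l ^ 2)| ≤
      (a + a ^ 2 * b) / n * ((r * N) ^ 2 * (C * gaussMass A)) := by gcongr
  have h2 : 0 ≤ 3 * (C * (r + 1 + 2 * (a + a ^ 2 * b)) * (N ^ 4 / n) * gaussMass A) := by
    positivity
  linarith

/-- With `g = θ_kθ_l²` the main part of the derivative is `θ_l²`, whence `½ · ½ = 1/4`. The cross
term has an off-diagonal coefficient, so the crude bound `(rN)²` on `θ_kθ_l` suffices. -/
lemma SteinBound.abs_bracket_sq_mul_sq_sub_le (ha : 0 < a) (hb : 0 < b) (hC : 0 ≤ C)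
    (hN : 1 ≤ N) (hr : 0 ≤ r) (hS : SteinBound C N A H Ω) (hA : IsAdmissible a b A)
    (hH : IsPerturbation c₁ c₂ A H) (hΩm : NullMeasurableSet Ω volume)
    (hΩ : Ω ⊆ cube n (r * N))
    (hI : bracket (action A H) Ω (fun _ => (1 : ℝ)) ≤ C * gaussMass A) {k l : Fin n}
    (hkl : k ≠ l) :
    |bracket (action A H) Ω (fun θ => θ k ^ 2 * θ l ^ 2) -
        1 / 4 * bracket (action A H) Ω (fun _ => (1 : ℝ))| ≤
      quarticConst a b r C * (N ^ 7 / n) * gaussMass A := by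
  have hG := gaussMass_nonneg A
  have hI0 := bracket_one_nonneg (Ω := Ω) (action A H)
  have hRN : 0 ≤ r * N := by positivity
  have hQ := hS.abs_bracket_sq_sub_le ha hb hC hN hr hA hH hΩ hI l
  have hQ' := abs_bracket_sq_le hRN hH hΩm hΩ hI l
  have hkk := hA.abs_inv_diag_sub_one_le ha hb k
  have hlk := hA.abs_inv_le ha hb hkl.symm
  have hP : |bracket (action A H) Ω (fun θ => θ k * θ l)| ≤ (r * N) ^ 2 * (C * gaussMass A) := by
    refine (norm_bracket_le hH hΩm hRN hΩ (g := fun θ => θ k * θ l)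
      (B := (r * N) ^ 2) fun θ hθ => ?_).trans (by gcongr)
    rw [norm_mul, Real.norm_eq_abs, Real.norm_eq_abs, sq]
    have := hΩ hθ k
    have := hΩ hθ l
    gcongr
  have hd : ∀ θ, HasLineDerivAt ℝ (fun θ : Fin n → ℝ => θ k * θ l ^ 2)
      (A⁻¹ k k * θ l ^ 2 + 2 * A⁻¹ l k * (θ k * θ l)) θ (A⁻¹ *ᵥ Pi.single k 1) := fun θ => by
    refine ((hasDerivAt_coord A θ k k).mul ((hasDerivAt_coord A θ l k).pow 2)).congr_deriv ?_
    simp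
    ring
  have hG₁ : ∀ θ ∈ Ω, |A⁻¹ k k * θ l ^ 2 + 2 * A⁻¹ l k * (θ k * θ l)| ≤
      3 * (r * N) ^ 2 * (1 + (a + a ^ 2 * b)) := by
    intro θ hθ
    have h1 := hΩ hθ k
    have h2 := hΩ hθ l
    have h3 := hA.abs_inv_le_one_add ha hb k k
    have h4 := hA.abs_inv_le_one_add ha hb l k
    refine (abs_add_le _ _).trans ?_
    rw [abs_mul, abs_mul, abs_mul, abs_mul, abs_pow, abs_two]
    calc _ ≤ (1 + (a + a ^ 2 * b)) * (r * N) ^ 2 +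
          2 * (1 + (a + a ^ 2 * b)) * (r * N * (r * N)) := by gcongr
      _ = _ := by ring
  have hG₀ : ∀ θ ∈ Ω, |θ k * θ l ^ 2| ≤ (r * N) ^ 3 := by
    intro θ hθ
    have h1 := hΩ hθ k
    have h2 := hΩ hθ l
    rw [abs_mul, abs_pow, pow_succ' _ 2]
    gcongr
  refine (hS.abs_sub_le hH hRN hΩ k (g := fun θ => θ k * θ l ^ 2)
    (g' := fun θ => A⁻¹ k k * θ l ^ 2 + 2 * A⁻¹ l k * (θ k * θ l)) (by fun_prop) (by fun_prop)
    hd hG₀ hG₁ (fun θ => by ring) le_rfl).trans (quarticConst_bound ha hb hC hN hr hG ?_)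
  rw [bracket_add hH hRN hΩ (by fun_prop) (by fun_prop), bracket_const_mul, bracket_const_mul]
  set Q := bracket (action A H) Ω (fun θ => θ l ^ 2)
  set P := bracket (action A H) Ω (fun θ => θ k * θ l)
  set I := bracket (action A H) Ω (fun _ => (1 : ℝ))
  have e : A⁻¹ k k * Q + 2 * A⁻¹ l k * P - 2 * (1 / 4) * I =
      (A⁻¹ k k - 1) * Q + 2 * (A⁻¹ l k * P) + (Q - 1 / 2 * I) := by
    ring
  rw [e]
  refine (abs_add_three _ _ _).trans ?_
  rw [abs_mul, abs_mul, abs_mul, abs_two]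
  have h1 : |A⁻¹ k k - 1| * |Q| ≤ (a + a ^ 2 * b) / n * ((r * N) ^ 2 * (C * gaussMass A)) := by
    gcongr
  have h2 : |A⁻¹ l k| * |P| ≤ (a + a ^ 2 * b) / n * ((r * N) ^ 2 * (C * gaussMass A)) := by
    gcongr
  have h3 := abs_nonneg (Q - 1 / 2 * I)
  linarith

end Moments

/-! ### Assembly -/

lemma rpow_neg_one_add_mul {ε : ℝ} (hn : 0 < n) (m : ℕ) :
    (n : ℝ) ^ (-1 + (m : ℝ) * ε) = ((n : ℝ) ^ ε) ^ m / n := by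
  have hn' : (0 : ℝ) < n := by exact_mod_cast hn
  rw [Real.rpow_add hn', Real.rpow_neg_one, mul_comm (m : ℝ), Real.rpow_mul hn'.le,
    Real.rpow_natCast]
  ring

end GaussInt

theorem lemma4p1 (a b ε r₁ r₂ c₁ c₂ : ℝ) (ha : 0 < a) (hb : 0 < b) (hε : 0 < ε)
    (hr₁ : 0 < r₁) (hr₂ : r₁ < r₂) (hc₁ : 0 < c₁) (hc₂ : 0 < c₂) :
    ∃ C c₃ : ℝ, 0 < C ∧ 0 < c₃ ∧ ∀ c₄ : ℝ, 0 < c₄ → ∃ C' : ℝ, 0 < C' ∧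
      ∀ (n : ℕ), 0 < n →
      ∀ (A : Matrix (Fin n) (Fin n) ℝ) (H : (Fin n → ℝ) → ℝ) (Ω : Set (Fin n → ℝ)),
      GaussInt.IsAdmissible a b A →
      GaussInt.IsPerturbation c₁ c₂ A H →
      NullMeasurableSet Ω volume →
      GaussInt.cube n (r₁ * (n : ℝ) ^ ε) ⊆ Ω →
      Ω ⊆ GaussInt.cube n (r₂ * (n : ℝ) ^ ε) →
      |GaussInt.bracket (GaussInt.action A 0) Ω (fun _ => (1 : ℝ)) - GaussInt.gaussMass A|
          ≤ C * Real.exp (-c₃ * (n : ℝ) ^ (2 * ε)) * GaussInt.gaussMass A ∧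
      |GaussInt.bracket (GaussInt.action A H) Ω (fun _ => (1 : ℝ))|
          ≤ C * GaussInt.gaussMass A ∧
      (∀ k : Fin n,
        |GaussInt.bracket (GaussInt.action A H) Ω (fun θ => θ k ^ 2)
            - 1 / 2 * GaussInt.bracket (GaussInt.action A H) Ω (fun _ => (1 : ℝ))|
          ≤ C * (n : ℝ) ^ (-1 + 4 * ε) * GaussInt.gaussMass A) ∧
      (∀ k : Fin n,
        |GaussInt.bracket (GaussInt.action A H) Ω (fun θ => θ k ^ 4)
            - 3 / 4 * GaussInt.bracket (GaussInt.action A H) Ω (fun _ => (1 : ℝ))|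
          ≤ C * (n : ℝ) ^ (-1 + 7 * ε) * GaussInt.gaussMass A) ∧
      (∀ k l : Fin n, k ≠ l →
        |GaussInt.bracket (GaussInt.action A H) Ω (fun θ => θ k * θ l)|
          ≤ C * (n : ℝ) ^ (-1 + 5 * ε) * GaussInt.gaussMass A) ∧
      (∀ k l : Fin n, k ≠ l →
        |GaussInt.bracket (GaussInt.action A H) Ω (fun θ => θ k * θ l ^ 3)|
          ≤ C * (n : ℝ) ^ (-1 + 7 * ε) * GaussInt.gaussMass A) ∧
      (∀ k l : Fin n, k ≠ l →
        |GaussInt.bracket (GaussInt.action A H) Ω (fun θ => θ k ^ 2 * θ l ^ 2)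
            - 1 / 4 * GaussInt.bracket (GaussInt.action A H) Ω (fun _ => (1 : ℝ))|
          ≤ C * (n : ℝ) ^ (-1 + 7 * ε) * GaussInt.gaussMass A) ∧
      (∀ p : Fin n → ℝ, ‖p‖ ≤ c₄ * (n : ℝ) ^ (-(1 / 2) : ℝ) → ∀ k : Fin n,
        ‖GaussInt.bracket (GaussInt.action A H) Ω
              (fun θ => (θ k : ℂ) * GaussInt.osc p k θ)
            - Complex.I / 2 * ((∑ j ∈ Finset.univ.erase k, p j * A⁻¹ j k : ℝ) : ℂ) *
              GaussInt.bracket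
                (fun θ => GaussInt.action A H θ - 1 / 2 * p k ^ 2 * θ k ^ 2) Ω
                (GaussInt.osc p k)‖
          ≤ C' * (n : ℝ) ^ (-1 + 5 * ε) * GaussInt.gaussMass A) := by
  obtain ⟨C, c₃, hC, hc₃, hmain⟩ :=
    GaussInt.exists_bracket_bounds a b ε r₁ r₂ c₁ c₂ ha hb hε hr₁ hr₂ hc₁ hc₂
  have hr₂0 : 0 < r₂ := hr₁.trans hr₂
  set D₁ := C * (r₂ + 1 + 2 * (a + a ^ 2 * b)) with hD₁
  set D₂ := GaussInt.quarticConst a b r₂ C with hD₂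
  have hD₁0 : 0 < D₁ := by positivity
  have hD₂0 : 0 < D₂ := by
    rw [hD₂, GaussInt.quarticConst]
    positivity
  refine ⟨C + D₁ + D₂, c₃, by positivity, hc₃, fun c₄ hc₄ => ?_⟩
  -- The first summand is the Stein error, the second the cost of changing the weight.
  set D₃ := C * (1 + c₄ * (a + a ^ 2 * b)) + c₄ * (a + a ^ 2 * b) * (c₄ ^ 2 * r₂ ^ 2 * C) with hD₃
  refine ⟨D₃, by positivity, ?_⟩
  intro n hn A H Ω hA hH hΩm hΩ₁ hΩ₂
  obtain ⟨hgauss, hI, hS⟩ := hmain n hn A H Ω hA hH hΩm hΩ₁ hΩ₂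
  rw [← GaussInt.bracket_one] at hI
  have hn' : (0 : ℝ) < n := by exact_mod_cast hn
  have hn1 : (1 : ℝ) ≤ n := by exact_mod_cast hn
  have hN1 : 1 ≤ (n : ℝ) ^ ε := Real.one_le_rpow hn1 hε.le
  have e4 := GaussInt.rpow_neg_one_add_mul (ε := ε) hn 4
  have e5 := GaussInt.rpow_neg_one_add_mul (ε := ε) hn 5
  have e7 := GaussInt.rpow_neg_one_add_mul (ε := ε) hn 7
  push_cast at e4 e5 e7
  rw [e4, e5, e7]
  set N := (n : ℝ) ^ ε with hN
  have hN0 : 0 < N := by linarith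
  have hG := GaussInt.gaussMass_nonneg A
  set G := GaussInt.gaussMass A with hGdef
  have h45 : N ^ 4 ≤ N ^ 5 := pow_le_pow_right₀ hN1 (by norm_num)
  have hCle : C ≤ C + D₁ + D₂ := by linarith
  have hD₁le : D₁ ≤ C + D₁ + D₂ := by linarith
  have hD₂le : D₂ ≤ C + D₁ + D₂ := by linarith
  refine ⟨hgauss.trans (by gcongr), ?_, fun k => ?_, fun k => ?_, fun k l hkl => ?_,
    fun k l hkl => ?_, fun k l hkl => ?_, fun p hp k => ?_⟩
  · rw [abs_of_nonneg (GaussInt.bracket_one_nonneg _)]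
    exact hI.trans (by gcongr)
  · exact (hS.abs_bracket_sq_sub_le ha hb hC.le hN1 hr₂0.le hA hH hΩ₂ hI k).trans (by gcongr)
  · exact (hS.abs_bracket_pow_four_sub_le ha hb hC.le hN1 hr₂0.le hA hH hΩm hΩ₂ hI k).trans
      (by gcongr)
  · exact (hS.abs_bracket_mul_le ha hb hC.le hN1 hr₂0.le hA hH hΩ₂ hI hkl).trans (by gcongr)
  · exact (hS.abs_bracket_mul_pow_three_le ha hb hC.le hN1 hr₂0.le hA hH hΩm hΩ₂ hI hkl).trans
      (by gcongr)
  · exact (hS.abs_bracket_sq_mul_sq_sub_le ha hb hC.le hN1 hr₂0.le hA hH hΩm hΩ₂ hI hkl).trans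
      (by gcongr)
  -- The decay of `p` enters only here, to supply the `1/n` in the change of weight; elsewhere `‖p‖
  -- ≤ c₄` is enough.
  · have hp2 : ‖p‖ ^ 2 ≤ c₄ ^ 2 / n := by
      calc ‖p‖ ^ 2 ≤ (c₄ * (n : ℝ) ^ (-(1 / 2) : ℝ)) ^ 2 := by gcongr
        _ = c₄ ^ 2 / n := by
            rw [mul_pow, ← Real.rpow_natCast ((n : ℝ) ^ _), ← Real.rpow_mul hn'.le]
            norm_num [Real.rpow_neg_one]
            rfl
    have hpc : ‖p‖ ≤ c₄ := by
      refine hp.trans (mul_le_of_le_one_right hc₄.le ?_)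
      exact Real.rpow_le_one_of_one_le_of_nonpos hn1 (by norm_num)
    refine (hS.norm_bracket_osc_le ha hb hc₄.le hA hH hΩm (by positivity) hΩ₂ hI hpc k).trans ?_
    have h1 : 1 ≤ N ^ 5 := one_le_pow₀ hN1
    have h2 : N ^ 2 ≤ N ^ 5 := pow_le_pow_right₀ hN1 (by norm_num)
    have h3 : N ^ 3 ≤ N ^ 5 := pow_le_pow_right₀ hN1 (by norm_num)
    calc _ ≤ C * ((N ^ 5 + c₄ * (a + a ^ 2 * b) * N ^ 5) / n) * G +
          c₄ * (a + a ^ 2 * b) * (c₄ ^ 2 / n * (r₂ ^ 2 * N ^ 5) * (C * G)) := by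
          rw [mul_pow r₂]
          have : c₄ * (a + a ^ 2 * b) ≤ c₄ * (a + a ^ 2 * b) * N ^ 5 :=
            le_mul_of_one_le_right (by positivity) h1
          gcongr
      _ = D₃ * (N ^ 5 / n) * G := by
          rw [hD₃]
          ring
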